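/- Let $\mathbb R^3_1$ be $\mathbb R^3$ with coordinates $(x_0,x_1,x_2)$, the Lorentzian inner product $\langle x,y\rangle=-x_0y_0+x_1y_1+x_2y_2$ and the Euclidean norm $|\cdot|_E$; let $r=\infty$ or $r=\omega$ (real analytic), and let $M$ be a $C^r$ 2-manifold (Hausdorff, second countable, not necessarily connected). A $C^r$-map $F:M\to\mathbb R^3_1$ is a (co-orientable) *wave front* if there is a $C^r$-map $\alpha:M\to(\mathbb R^3)^*\setminus\{0\}$ with $\alpha_p(dF_p(v))=0$ for all $p\in M$, $v\in T_pM$, such that $(F,[\alpha]):M\to\mathbb R^3\times P((\mathbb R^3)^*)$ is an immersion. It is *null* if the vector field $\hat\xi$ along $F$ defined by $\langle\hat\xi_p,\cdot\rangle=\alpha_p$ is light-like, i.e. $\langle\hat\xi_p,\hat\xi_p\rangle=0$ for all $p$; then its *E-normalized* normal field $\hat\xi_E$ is the future-pointing light-like normal $C^r$ vector field along $F$ with $|\hat\xi_E|_E=\sqrt2$, and $\xi_E$ denotes the (unique) $C^r$ tangent vector field on $M$ with $dF(\xi_E)=\hat\xi_E$. The null wave front $F$ is *L-complete* if through every $p\in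 M$ there passes an integral curve $\gamma:\mathbb R\to M$ of $\xi_E$ such that $F(\gamma(\mathbb R))$ is an entire light-like line. It is *complete* if it is L-complete and its singular set (the set of points of $M$ at which $F$ is not an immersion) is non-empty and compact. A point $p$ is a *cuspidal edge* of $F$ if, after composition with local $C^\infty$-diffeomorphisms of $M$ at $p$ and of $\mathbb R^3$ at $F(p)$, $F$ becomes the germ $(u,v)\mapsto(u,v^2,v^3)$ at the origin. **Statement.** Let $F:M\to\mathbb R^3_1$ be a complete null wave front whose image is not a plane and which has no self-intersections outside a compact set: there is a compact $K\subset\mathbb R^3_1$ such that $F(p)=F(q)$ with $p\ne q$ implies $F(p)\in K$. Then $F$ has at least four singular points (points of $M$) that are not cuspidal edges. Moreover, these come from the vertices of a generating closed convex plane curve. Let $N$ be a connected component of $M$ containing a singular point (so $N=M$ if $M$ is connected). Then there are $t_0\in\mathbb R$, $\ell>0$, a regular $\ell$-periodic $C^r$-curve $c:\mathbb R\to\mathbb R^2$, injective on $[0,\ell)$, with a $C^r$ unit normal field $\nu$ with respect to which its curvature $\kappa$ is positive everywhere, and a $C^r$-diffeomorphism $\Phi:\mathbb R\times(\mathbb R/\ell\mathbb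 Z)\to N$, such that $$F(\Phi(t,s))=(t_0+t,\;c(s)+t\,\nu(s)).$$ The curve $c$ has at least four vertices (points $s\in[0,\ell)$ with $\kappa'(s)=0$), and for each vertex $s$ the point $\Phi(1/\kappa(s),s)$ is a singular point of $F$ that is not a cuspidal edge. -/

import Mathlib

open Set Function
open scoped Manifold ContDiff Topology

noncomputable section

/-- The Euclidean plane. -/
abbrev Plane := EuclideanSpace ℝ (Fin 2)

/-- The vector space underlying Lorentz-Minkowski 3-space; the coordinate `0` is time.
Its norm is the Euclidean norm `|·|_E`. -/
abbrev Minkowski3 := EuclideanSpace ℝ (Fin 3)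

/-- The Lorentzian inner product of signature `(-,+,+)`. -/
def lorentz (x y : Minkowski3) : ℝ := -(x 0 * y 0) + x 1 * y 1 + x 2 * y 2

section NullFronts

variable {M : Type*} [TopologicalSpace M] [ChartedSpace Plane M]

/-- `F` is a (co-orientable) `C^r` wave front, and `α` is a lift to the nonzero covectors of its
projective Gauss map `p ↦ [α p]`. The field `immersion` says that `p ↦ (F p, [α p])` is an
immersion: the differential of `p ↦ [α p]` kills `v` exactly when `dα v` is a multiple of `α p`. -/
structure IsFrontWithConormal (r : WithTop ℕ∞) (F : M → Minkowski3)
    (α : M → (Minkowski3 →L[ℝ] ℝ)) : Prop where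
  contMDiff : ContMDiff (𝓡 2) 𝓘(ℝ, Minkowski3) r F
  contMDiff_conormal : ContMDiff (𝓡 2) 𝓘(ℝ, Minkowski3 →L[ℝ] ℝ) r α
  ne_zero : ∀ p, α p ≠ 0
  conormal : ∀ (p : M) (v : TangentSpace (𝓡 2) p),
    α p (mfderiv (𝓡 2) 𝓘(ℝ, Minkowski3) F p v) = 0
  immersion : ∀ (p : M) (v : TangentSpace (𝓡 2) p),
    mfderiv (𝓡 2) 𝓘(ℝ, Minkowski3) F p v = 0 →
    (∃ c : ℝ, mfderiv (𝓡 2) 𝓘(ℝ, Minkowski3 →L[ℝ] ℝ) α p v = c • α p) → v = 0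

/-- `F` is a `C^r` null wave front: the normal vector field `ξ` that represents the conormal
through the Lorentzian inner product is light-like at every point. -/
def IsNullWaveFront (r : WithTop ℕ∞) (F : M → Minkowski3) : Prop :=
  ∃ α : M → (Minkowski3 →L[ℝ] ℝ), IsFrontWithConormal r F α ∧
    ∃ ξ : M → Minkowski3, (∀ p x, lorentz (ξ p) x = α p x) ∧ ∀ p, lorentz (ξ p) (ξ p) = 0

/-- `ξ` is the E-normalized normal vector field along the null wave front `F`: it is normal,
light-like, future-pointing and of Euclidean length `√2`. -/
structure IsENormalizedNormal (r : WithTop ℕ∞) (F ξ : M → Minkowski3) : Prop where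
  contMDiff : ContMDiff (𝓡 2) 𝓘(ℝ, Minkowski3) r ξ
  normal : ∀ (p : M) (v : TangentSpace (𝓡 2) p),
    lorentz (ξ p) (mfderiv (𝓡 2) 𝓘(ℝ, Minkowski3) F p v) = 0
  null : ∀ p, lorentz (ξ p) (ξ p) = 0
  future : ∀ p, 0 < ξ p 0
  norm_eq : ∀ p, ‖ξ p‖ = √2

/-- `X` is the E-normalized null vector field of the null wave front `F`, the `C^r` tangent vector
field on `M` which `dF` maps to the E-normalized normal vector field. (It is unique, because the
regular points of a null wave front are dense.) -/
def IsENormalizedNullField [IsManifold (𝓡 2) ∞ M] (r : WithTop ℕ∞) (F : M → Minkowski3)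
    (X : (p : M) → TangentSpace (𝓡 2) p) : Prop :=
  ContMDiff (𝓡 2) (𝓡 2).tangent r (fun p => (⟨p, X p⟩ : TangentBundle (𝓡 2) M)) ∧
    ∃ ξ : M → Minkowski3, IsENormalizedNormal r F ξ ∧
      ∀ p, mfderiv (𝓡 2) 𝓘(ℝ, Minkowski3) F p (X p) = ξ p

/-- An entire light-like line. -/
def IsLightlikeLine (s : Set Minkowski3) : Prop :=
  ∃ x w : Minkowski3, w ≠ 0 ∧ lorentz w w = 0 ∧ s = range fun t : ℝ => x + t • w

/-- L-completeness: through every point passes an integral curve `ℝ → M` of the E-normalized null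
vector field which `F` maps onto an entire light-like line. -/
def IsLComplete [IsManifold (𝓡 2) ∞ M] (r : WithTop ℕ∞) (F : M → Minkowski3) : Prop :=
  ∃ X : (p : M) → TangentSpace (𝓡 2) p, IsENormalizedNullField r F X ∧
    ∀ p : M, ∃ γ : ℝ → M, IsMIntegralCurve (I := 𝓡 2) γ X ∧ p ∈ range γ ∧
      IsLightlikeLine (range (F ∘ γ))

/-- The set of the points at which `F` is not an immersion. -/
def singularSet (F : M → Minkowski3) : Set M :=
  {p | ¬ Injective (mfderiv (𝓡 2) 𝓘(ℝ, Minkowski3) F p)}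

/-- A complete null wave front. -/
structure IsCompleteNullWaveFront [IsManifold (𝓡 2) ∞ M] (r : WithTop ℕ∞)
    (F : M → Minkowski3) : Prop where
  nullWaveFront : IsNullWaveFront r F
  lComplete : IsLComplete r F
  singular_nonempty : (singularSet F).Nonempty
  singular_compact : IsCompact (singularSet F)

/-- `F` has a cuspidal edge at `p`: there are local diffeomorphisms `φ` at `p` and `ψ` at `F p`,
centred at the origin, in which `F` takes the form `(u, v) ↦ (u, v², v³)`. -/
def IsCuspidalEdge (F : M → Minkowski3) (p : M) : Prop :=
  ∃ (φ : OpenPartialHomeomorph M Plane) (ψ : OpenPartialHomeomorph Minkowski3 Minkowski3),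
    ContMDiffOn (𝓡 2) (𝓡 2) ∞ φ φ.source ∧ ContMDiffOn (𝓡 2) (𝓡 2) ∞ φ.symm φ.target ∧
    ContDiffOn ℝ ∞ ψ ψ.source ∧ ContDiffOn ℝ ∞ ψ.symm ψ.target ∧
    p ∈ φ.source ∧ φ p = 0 ∧ F p ∈ ψ.source ∧ ψ (F p) = 0 ∧
    ∀ q ∈ φ.source, F q ∈ ψ.source ∧ ψ (F q) = !₂[φ q 0, (φ q 1) ^ 2, (φ q 1) ^ 3]

/-- The image of `F` is an affine plane. -/
def IsPlanar (F : M → Minkowski3) : Prop :=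
  ∃ P : AffineSubspace ℝ Minkowski3,
    Module.finrank ℝ P.direction = 2 ∧ range F = (P : Set Minkowski3)

end NullFronts

/-- The curvature, with respect to the unit normal `ν`, of a regular plane curve `c` with an
arbitrary parameter. -/
def planeCurvature (c ν : ℝ → Plane) (s : ℝ) : ℝ :=
  inner ℝ (deriv (deriv c) s) (ν s) / ‖deriv c s‖ ^ 2

/-- `c` is an `ℓ`-periodic regular parametrization of a simple closed curve whose curvature with
respect to the unit normal `ν` is positive everywhere, i.e. of a closed convex plane curve with
inward unit normal `ν`. -/
structure IsConvexClosedCurve (r : WithTop ℕ∞) (ℓ : ℝ) (c ν : ℝ → Plane) : Prop where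
  period_pos : 0 < ℓ
  contDiff : ContDiff ℝ r c
  contDiff_normal : ContDiff ℝ r ν
  periodic : Periodic c ℓ
  simple : InjOn c (Ico 0 ℓ)
  regular : ∀ s, deriv c s ≠ 0
  norm_normal : ∀ s, ‖ν s‖ = 1
  normal : ∀ s, inner ℝ (deriv c s) (ν s) = 0
  curvature_pos : ∀ s, 0 < planeCurvature c ν s

/-- A vertex is a critical point of the curvature. -/
def IsVertex (c ν : ℝ → Plane) (s : ℝ) : Prop := deriv (planeCurvature c ν) s = 0

/-- The normal form `(t, s) ↦ (0, c(s)) + t (1, ν(s))`, with the curve placed at time `t₀`. -/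
def nullNormalForm (t₀ : ℝ) (c ν : ℝ → Plane) (x : ℝ × ℝ) : Minkowski3 :=
  !₂[t₀ + x.1, c x.2 0 + x.1 * ν x.2 0, c x.2 1 + x.1 * ν x.2 1]

/-- `Φ` identifies `ℝ × (ℝ / ℓℤ)` with the subset `N` of `M`, `C^r`-diffeomorphically, and turns
`F` on `N` into the normal form generated by the curve `c` with unit normal `ν`. -/
structure IsGeneratedBy {M : Type*} [TopologicalSpace M] [ChartedSpace Plane M]
    (r : WithTop ℕ∞) (F : M → Minkowski3) (N : Set M)
    (t₀ ℓ : ℝ) (c ν : ℝ → Plane) (Φ : ℝ × ℝ → M) : Prop where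
  localDiffeo : IsLocalDiffeomorph 𝓘(ℝ, ℝ × ℝ) (𝓡 2) r Φ
  range_eq : range Φ = N
  eq_iff : ∀ x y : ℝ × ℝ, Φ x = Φ y ↔ x.1 = y.1 ∧ ∃ k : ℤ, y.2 = x.2 + k * ℓ
  normalForm : ∀ x, F (Φ x) = nullNormalForm t₀ c ν x

end

/-! Normalization makes the null normal equal to `(1, ν)` with `|ν| = 1`, and L-completeness makes
it constant along each ray. Hence `F = (τ, y + τ ν)` with `y` and `ν` constant along rays, and
normality makes `dy` and `dν` real multiples of `iν` (`exists_isRulingData`). A point is singular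
exactly when `dy + τ dν = 0`. A ray with `dν ≠ 0` carries one singular point, at a time `T`; a ray
with `dν = 0` has `dy ≠ 0` by the front condition and carries none. Compactness of the singular set
bounds `T`, so `dy = -T dν` keeps rays of the first kind from accumulating at one of the second: the
points with `dν ≠ 0` form a clopen set (`isClopen_dir_ne_zero`).

On the component of a singular point, `(τ, ν)` is therefore a local homeomorphism to `ℝ × S¹`. Every
ray there meets the compact singular set, so this map is proper, hence a covering
(`isCoveringMap_of_flow`), and the plane of pairs `(t, s)` parametrizes the component, with `ν =
e^{is}` and `y' = -T i e^{is}`.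

At a very negative time `t₀` the slice `c = y + t₀ e^{is}` has radius of curvature `T - t₀ > 0`,
winds around the origin, and meets itself only where the points of `M` coincide. It cannot spiral:
`|c|` attains a maximum by compactness, and comparing `|c|` with its value one turn later forces a
meeting (`exists_eq_add_two_pi`). So the covering has one sheet and `c` is a closed convex curve.

Since `c` closes up, its radius of curvature is orthogonal to `cos` and `sin`, which yields four
critical points (`four_le_encard_deriv_eq_zero`). There `T' = 0`: the curve of singular points is
immersed in `M`, but its image under `F` has velocity `T' (1, ν) = 0`. At a cuspidal edge `F`
immerses such a curve (`IsCuspidalEdge.diffTo_eq_zero`). -/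

/-! ### Differentials in charts and the inverse function theorem. -/

section InverseFunction

variable {E E' : Type*} [NormedAddCommGroup E] [NormedSpace ℝ E]
  [NormedAddCommGroup E'] [NormedSpace ℝ E']
  {M : Type*} [TopologicalSpace M] [ChartedSpace E M]

/-- A curve through `p` with velocity `v`: a straight line in the preferred chart at `p`. -/
noncomputable def chartLine (p : M) (v : E) (t : ℝ) : M :=
  (chartAt E p).symm (chartAt E p p + t • v)

theorem chartLine_zero (p : M) (v : E) : chartLine p v 0 = p := by
  simp [chartLine]

/-- The differential at `p` of a vector-valued map, read in the preferred chart at `p`. -/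
noncomputable def diffAt (E : Type*) [NormedAddCommGroup E] [NormedSpace ℝ E]
    {M : Type*} [TopologicalSpace M] [ChartedSpace E M] (f : M → E') (p : M) : E →L[ℝ] E' :=
  fderiv ℝ (f ∘ (chartAt E p).symm) (chartAt E p p)

theorem hasFDerivAt_comp_chart_symm {f : M → E'} {p : M}
    (hf : MDifferentiableAt 𝓘(ℝ, E) 𝓘(ℝ, E') f p) :
    HasFDerivAt (f ∘ (chartAt E p).symm) (diffAt E f p) (chartAt E p p) := by
  have h' : DifferentiableWithinAt ℝ (f ∘ (chartAt E p).symm) (range 𝓘(ℝ, E)) (chartAt E p p) :=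
    hf.differentiableWithinAt_writtenInExtChartAt
  rw [ModelWithCorners.range_eq_univ, differentiableWithinAt_univ] at h'
  exact h'.hasFDerivAt

theorem mfderiv_eq_diffAt {f : M → E'} {p : M} (hf : MDifferentiableAt 𝓘(ℝ, E) 𝓘(ℝ, E') f p) :
    mfderiv 𝓘(ℝ, E) 𝓘(ℝ, E') f p = diffAt E f p := by
  have : fderivWithin ℝ (f ∘ (chartAt E p).symm) (range 𝓘(ℝ, E)) (chartAt E p p) = diffAt E f p := by
    rw [ModelWithCorners.range_eq_univ, fderivWithin_univ]; rfl
  exact (if_pos hf).trans this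

theorem hasDerivAt_comp_chartLine {f : M → E'} {p : M}
    (hf : MDifferentiableAt 𝓘(ℝ, E) 𝓘(ℝ, E') f p) (v : E) :
    HasDerivAt (f ∘ chartLine p v) (diffAt E f p v) 0 := by
  have h2 : HasDerivAt (fun t : ℝ => chartAt E p p + t • v) v 0 := by
    simpa using ((hasDerivAt_id (0 : ℝ)).smul_const v).const_add (chartAt E p p)
  exact HasFDerivAt.comp_hasDerivAt (f := fun t : ℝ => chartAt E p p + t • v) (0 : ℝ)
    (by simpa using hasFDerivAt_comp_chart_symm hf) h2

theorem continuousAt_chartLine (p : M) (v : E) : ContinuousAt (chartLine p v) 0 := by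
  refine ContinuousAt.comp (g := (chartAt E p).symm) ?_ (by fun_prop)
  simpa using (chartAt E p).symm.continuousAt (mem_chart_target E p)

/-- The differential at `z` of a map from a vector space to a manifold, read in the preferred chart
at the image of `z`. -/
noncomputable def diffTo (E : Type*) [NormedAddCommGroup E] [NormedSpace ℝ E]
    {M : Type*} [TopologicalSpace M] [ChartedSpace E M]
    {E₁ : Type*} [NormedAddCommGroup E₁] [NormedSpace ℝ E₁] (g : E₁ → M) (z : E₁) : E₁ →L[ℝ] E :=
  mfderiv 𝓘(ℝ, E₁) 𝓘(ℝ, E) g z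

theorem hasFDerivAt_comp_diffTo {E₁ : Type*} [NormedAddCommGroup E₁] [NormedSpace ℝ E₁]
    {g : E₁ → M} {z : E₁} (hg : MDifferentiableAt 𝓘(ℝ, E₁) 𝓘(ℝ, E) g z) {f : M → E'}
    (hf : MDifferentiableAt 𝓘(ℝ, E) 𝓘(ℝ, E') f (g z)) :
    HasFDerivAt (f ∘ g) ((diffAt E f (g z)).comp (diffTo E g z)) z := by
  have h := (hf.hasMFDerivAt.comp z hg.hasMFDerivAt).hasFDerivAt
  rw [mfderiv_eq_diffAt hf] at h
  exact h

theorem hasDerivAt_comp_integralCurve {f : M → E'} {γ : ℝ → M}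
    {X : M → E} (hγ : IsMIntegralCurve (I := 𝓘(ℝ, E)) γ X) (t : ℝ)
    (hf : MDifferentiableAt 𝓘(ℝ, E) 𝓘(ℝ, E') f (γ t)) :
    HasDerivAt (f ∘ γ) (diffAt E f (γ t) (X (γ t))) t := by
  have h := (hf.hasMFDerivAt.comp t (hγ t)).hasFDerivAt
  rw [mfderiv_eq_diffAt hf] at h
  let L : ℝ →L[ℝ] E := (1 : ℝ →L[ℝ] ℝ).smulRight (X (γ t))
  have h' : HasFDerivAt (f ∘ γ) ((diffAt E f (γ t)).comp L) t := h
  have h2 := h'.hasDerivAt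
  have : ((diffAt E f (γ t)).comp L) 1 = diffAt E f (γ t) (X (γ t)) := by
    rw [ContinuousLinearMap.comp_apply]
    congr 1
    exact one_smul ℝ (X (γ t))
  rwa [this] at h2

variable [FiniteDimensional ℝ E] [FiniteDimensional ℝ E']

theorem exists_openPartialHomeomorph_of_injective_fderiv {r : WithTop ℕ∞} (hr : 1 ≤ r)
    (hd : Module.finrank ℝ E = Module.finrank ℝ E') {g : E → E'} {V : Set E} (hV : IsOpen V)
    (hg : ContDiffOn ℝ r g V) {u : E} (hu : u ∈ V) (hinj : Injective (fderiv ℝ g u)) :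
    ∃ h : OpenPartialHomeomorph E E', u ∈ h.source ∧ h.source ⊆ V ∧ (∀ x, h x = g x) ∧
      ContDiffOn ℝ r h h.source ∧ ContDiffOn ℝ r h.symm h.target := by
  have : CompleteSpace E := FiniteDimensional.complete ℝ E
  have hr0 : r ≠ 0 := by rintro rfl; simp at hr
  -- The inverse is `C^r` only where the derivative is invertible. This is an open condition, so
  -- restricting to `W` makes the inverse `C^r` on the whole target.
  let W : Set E := V ∩ fderiv ℝ g ⁻¹' range ((↑) : (E ≃L[ℝ] E') → (E →L[ℝ] E'))
  have hW : IsOpen W := (hg.continuousOn_fderiv_of_isOpen hV hr).isOpen_inter_preimage hV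
    ContinuousLinearEquiv.isOpen
  have heq : ∃ e : E ≃L[ℝ] E', (e : E →L[ℝ] E') = fderiv ℝ g u := by
    refine ⟨(LinearEquiv.ofInjectiveOfFinrankEq (fderiv ℝ g u : E →ₗ[ℝ] E') hinj
      hd).toContinuousLinearEquiv, ?_⟩
    ext x; rfl
  have huW : u ∈ W := ⟨hu, heq⟩
  obtain ⟨e, he⟩ := heq
  have hgu : ContDiffAt ℝ r g u := hg.contDiffAt (hV.mem_nhds hu)
  have hgd : HasFDerivAt g (e : E →L[ℝ] E') u := by
    rw [he]; exact (hgu.differentiableAt hr0).hasFDerivAt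
  let h0 := hgu.toOpenPartialHomeomorph g hgd hr0
  have h0g : ∀ x, h0 x = g x := fun x => rfl
  let h := h0.restrOpen W hW
  have hsW : h.source ⊆ W := fun x hx => by
    simp only [h, OpenPartialHomeomorph.restrOpen_source] at hx; exact hx.2
  have hg' : ∀ x, h x = g x := fun x => rfl
  refine ⟨h, ?_, fun x hx => (hsW hx).1, hg', ?_, ?_⟩
  · simp only [h, OpenPartialHomeomorph.restrOpen_source]
    exact ⟨hgu.mem_toOpenPartialHomeomorph_source hgd hr0, huW⟩
  · exact (hg.mono fun x hx => (hsW hx).1)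
  · intro y hy
    have hx := h.map_target hy
    obtain ⟨e', he'⟩ := (hsW hx).2
    have hgx : ContDiffAt ℝ r g (h.symm y) := hg.contDiffAt (hV.mem_nhds (hsW hx).1)
    refine (h.contDiffAt_symm (f₀' := e') hy ?_ hgx).contDiffWithinAt
    rw [he']; exact (hgx.differentiableAt hr0).hasFDerivAt

/-- The inverse function theorem for a map from a manifold to a vector space. -/
theorem isLocalDiffeomorphAt_of_injective_mfderiv {r : WithTop ℕ∞} (hr : 1 ≤ r)
    [IsManifold 𝓘(ℝ, E) r M]
    (hd : Module.finrank ℝ E = Module.finrank ℝ E') {f : M → E'} {U : Set M} (hU : IsOpen U)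
    (hf : ContMDiffOn 𝓘(ℝ, E) 𝓘(ℝ, E') r f U) {p : M} (hp : p ∈ U)
    (hinj : Injective (diffAt E f p)) :
    IsLocalDiffeomorphAt 𝓘(ℝ, E) 𝓘(ℝ, E') r f p := by
  have hr0 : r ≠ 0 := by rintro rfl; simp at hr
  let φ : PartialDiffeomorph 𝓘(ℝ, E) 𝓘(ℝ, E) M E r :=
    { toPartialEquiv := (chartAt E p).toPartialEquiv
      open_source := (chartAt E p).open_source
      open_target := (chartAt E p).open_target
      contMDiffOn_toFun := contMDiffOn_chart
      contMDiffOn_invFun := contMDiffOn_chart_symm }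
  let V : Set E := (chartAt E p).target ∩ (chartAt E p).symm ⁻¹' U
  have hV : IsOpen V := (chartAt E p).isOpen_inter_preimage_symm hU
  have hg : ContDiffOn ℝ r (f ∘ (chartAt E p).symm) V := by
    rw [← contMDiffOn_iff_contDiffOn]
    exact hf.comp (φ.contMDiffOn_invFun.mono inter_subset_left) fun x hx => hx.2
  have hpV : chartAt E p p ∈ V := ⟨mem_chart_target E p, by simpa using hp⟩
  have hfd : MDifferentiableAt 𝓘(ℝ, E) 𝓘(ℝ, E') f p :=
    (hf.contMDiffAt (hU.mem_nhds hp)).mdifferentiableAt hr0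
  have hfi : Injective (fderiv ℝ (f ∘ (chartAt E p).symm) (chartAt E p p)) := by
    rw [(hasFDerivAt_comp_chart_symm hfd).fderiv]; exact hinj
  obtain ⟨h, hu, hs, hh, h1, h2⟩ :=
    exists_openPartialHomeomorph_of_injective_fderiv hr hd hV hg hpV hfi
  let ψ : PartialDiffeomorph 𝓘(ℝ, E) 𝓘(ℝ, E') E E' r :=
    { toPartialEquiv := h.toPartialEquiv
      open_source := h.open_source
      open_target := h.open_target
      contMDiffOn_toFun := h1.contMDiffOn
      contMDiffOn_invFun := h2.contMDiffOn }
  refine ⟨φ.trans ψ, ⟨mem_chart_source E p, hu⟩, fun x hx => ?_⟩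
  have hx1 : x ∈ (chartAt E p).source := hx.1
  change f x = h (chartAt E p x)
  rw [hh, comp_apply, (chartAt E p).left_inv hx1]

end InverseFunction

/-! ### From a complete null front to its ruling by light rays. -/

section NullData

variable {M : Type*} [TopologicalSpace M] [ChartedSpace Plane M]

/-- The time `τ`, the position `y` at time zero and the direction `ν` of the light rays that rule
a complete null front, with the vector field `X` along the rays. -/
structure IsRulingData (r : WithTop ℕ∞) (τ : M → ℝ) (y ν : M → ℂ) (X : M → Plane) : Prop where
  smooth_time : ContMDiff (𝓡 2) 𝓘(ℝ, ℝ) r τ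
  smooth_pos : ContMDiff (𝓡 2) 𝓘(ℝ, ℂ) r y
  smooth_dir : ContMDiff (𝓡 2) 𝓘(ℝ, ℂ) r ν
  time_field : ∀ p, diffAt Plane τ p (X p) = 1
  pos_field : ∀ p, diffAt Plane y p (X p) = 0
  dir_field : ∀ p, diffAt Plane ν p (X p) = 0
  norm_dir : ∀ p, ‖ν p‖ = 1
  pos_tangent : ∀ p v, ∃ a : ℝ, diffAt Plane y p v = a * (Complex.I * ν p)
  dir_tangent : ∀ p v, ∃ a : ℝ, diffAt Plane ν p v = a * (Complex.I * ν p)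
  immersion : ∀ p v, diffAt Plane τ p v = 0 → diffAt Plane y p v = 0 →
    diffAt Plane ν p v = 0 → v = 0
  ray : ∀ p, ∃ γ : ℝ → M, IsMIntegralCurve (I := 𝓡 2) γ X ∧ γ 0 = p ∧
    ∀ t, τ (γ t) = τ p + t ∧ y (γ t) = y p ∧ ν (γ t) = ν p

/-- The factor is the signed area spanned by `w` and `z`, the coordinate of `z` along the quarter
turn of `w`. -/
theorem exists_eq_real_mul_I_mul {z w : ℂ} (hw : w.re ^ 2 + w.im ^ 2 = 1)
    (h : w.re * z.re + w.im * z.im = 0) : ∃ a : ℝ, z = a * (Complex.I * w) := by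
  refine ⟨w.re * z.im - w.im * z.re, ?_⟩
  apply Complex.ext
  · simp
    linear_combination (-z.re) * hw + w.re * h
  · simp
    linear_combination (-z.im) * hw + w.im * h

/-- With `A = dτ` and `X` the ray direction, a linear map that kills `X` is determined by its value
on one nonzero vector of `ker dτ`. -/
theorem exists_span_of_apply_eq_one {E : Type*} [NormedAddCommGroup E] [NormedSpace ℝ E]
    (hE : Module.finrank ℝ E = 2) (A : E →L[ℝ] ℝ) {X : E} (hX : A X = 1) :
    (∃ v, v ≠ 0 ∧ A v = 0) ∧ ∀ v, v ≠ 0 → A v = 0 → ∀ u, ∃ b : ℝ, u = A u • X + b • v := by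
  have : FiniteDimensional ℝ E := Module.finite_of_finrank_pos (by omega)
  have hsurj : Surjective (A : E →ₗ[ℝ] ℝ) := fun c => ⟨c • X, by simp [hX]⟩
  have hk : Module.finrank ℝ (LinearMap.ker (A : E →ₗ[ℝ] ℝ)) = 1 := by
    have := LinearMap.finrank_range_add_finrank_ker (A : E →ₗ[ℝ] ℝ)
    rw [LinearMap.range_eq_top.2 hsurj, finrank_top, Module.finrank_self, hE] at this
    omega
  constructor
  · obtain ⟨v, hv, -⟩ := finrank_eq_one_iff'.1 hk
    exact ⟨v, by simpa using hv, v.2⟩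
  · intro v hv hAv u
    have h := (finrank_eq_one_iff_of_nonzero' (⟨v, hAv⟩ : LinearMap.ker (A : E →ₗ[ℝ] ℝ))
      (fun h => hv (congrArg Subtype.val h))).1 hk ⟨u - A u • X, by simp [hX]⟩
    obtain ⟨b, hb⟩ := h
    have hb' : b • v = u - A u • X := congrArg Subtype.val hb
    exact ⟨b, by rw [hb']; abel⟩

theorem hasDerivAt_apply_coord {f : ℝ → Minkowski3} {f' : Minkowski3} {t : ℝ}
    (h : HasDerivAt f f' t) (i : Fin 3) : HasDerivAt (fun s => f s i) (f' i) t :=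
  (EuclideanSpace.proj (𝕜 := ℝ) i).hasFDerivAt.comp_hasDerivAt t h

theorem contMDiff_coord {r : WithTop ℕ∞} {F : M → Minkowski3}
    (h : ContMDiff (𝓡 2) 𝓘(ℝ, Minkowski3) r F) (i : Fin 3) :
    ContMDiff (𝓡 2) 𝓘(ℝ, ℝ) r (fun p => F p i) :=
  (EuclideanSpace.proj i : Minkowski3 →L[ℝ] ℝ).contMDiff.comp h

/-- The direction of the light ray with velocity `ξ`, as a complex number. -/
def rayDir (ξ : M → Minkowski3) (p : M) : ℂ := ξ p 1 + ξ p 2 * Complex.I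

/-- The position at time zero of the light ray through `F p` with velocity `ξ p`. -/
def rayPos (F ξ : M → Minkowski3) (p : M) : ℂ :=
  F p 1 + F p 2 * Complex.I - F p 0 * rayDir ξ p

variable {r : WithTop ℕ∞} {F ξ : M → Minkowski3}

theorem contMDiff_rayDir (h : ContMDiff (𝓡 2) 𝓘(ℝ, Minkowski3) r ξ) :
    ContMDiff (𝓡 2) 𝓘(ℝ, ℂ) r (rayDir ξ) := by
  have : ContDiff ℝ r (fun x : Minkowski3 => (x 1 : ℂ) + x 2 * Complex.I) := by
    have h (i : Fin 3) : ContDiff ℝ r (fun x : Minkowski3 => (x i : ℂ)) :=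
      Complex.ofRealCLM.contDiff.comp (EuclideanSpace.proj i : Minkowski3 →L[ℝ] ℝ).contDiff
    exact (h 1).add ((h 2).mul contDiff_const)
  exact this.comp_contMDiff h

theorem contMDiff_rayPos (hF : ContMDiff (𝓡 2) 𝓘(ℝ, Minkowski3) r F)
    (h : ContMDiff (𝓡 2) 𝓘(ℝ, Minkowski3) r ξ) :
    ContMDiff (𝓡 2) 𝓘(ℝ, ℂ) r (rayPos F ξ) := by
  have : ContDiff ℝ r (fun x : Minkowski3 × ℂ => (x.1 1 : ℂ) + x.1 2 * Complex.I - x.1 0 * x.2) := by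
    have h (i : Fin 3) : ContDiff ℝ r (fun x : Minkowski3 × ℂ => (x.1 i : ℂ)) :=
      Complex.ofRealCLM.contDiff.comp
        ((EuclideanSpace.proj i : Minkowski3 →L[ℝ] ℝ).contDiff.comp contDiff_fst)
    exact ((h 1).add ((h 2).mul contDiff_const)).sub ((h 0).mul contDiff_snd)
  exact this.comp_contMDiff (hF.prodMk_space (contMDiff_rayDir h))

theorem diffAt_coord (hF : ContMDiff (𝓡 2) 𝓘(ℝ, Minkowski3) r F) (hr : r ≠ 0) (p : M) (v : Plane)
    (i : Fin 3) : diffAt Plane (fun q => F q i) p v = diffAt Plane F p v i := by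
  have h1 := hasDerivAt_comp_chartLine ((contMDiff_coord hF i).mdifferentiable hr p) v
  exact h1.unique (hasDerivAt_apply_coord
    (hasDerivAt_comp_chartLine (hF.mdifferentiable hr p) v) i)

theorem diffAt_rayDir (hξ : ContMDiff (𝓡 2) 𝓘(ℝ, Minkowski3) r ξ) (hr : r ≠ 0) (p : M) (v : Plane) :
    diffAt Plane (rayDir ξ) p v =
      (diffAt Plane ξ p v 1 : ℂ) + diffAt Plane ξ p v 2 * Complex.I := by
  have h1 := hasDerivAt_comp_chartLine ((contMDiff_rayDir hξ).mdifferentiable hr p) v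
  have h2 := hasDerivAt_apply_coord (hasDerivAt_comp_chartLine (hξ.mdifferentiable hr p) v)
  exact h1.unique ((h2 1).ofReal_comp.add ((h2 2).ofReal_comp.mul_const _))

theorem diffAt_rayPos (hF : ContMDiff (𝓡 2) 𝓘(ℝ, Minkowski3) r F)
    (hξ : ContMDiff (𝓡 2) 𝓘(ℝ, Minkowski3) r ξ) (hr : r ≠ 0) (p : M) (v : Plane) :
    diffAt Plane (rayPos F ξ) p v =
      (diffAt Plane F p v 1 : ℂ) + diffAt Plane F p v 2 * Complex.I -
        (diffAt Plane F p v 0 * rayDir ξ p + F p 0 * diffAt Plane (rayDir ξ) p v) := by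
  have h1 := hasDerivAt_comp_chartLine ((contMDiff_rayPos hF hξ).mdifferentiable hr p) v
  have h2 := hasDerivAt_apply_coord (hasDerivAt_comp_chartLine (hF.mdifferentiable hr p) v)
  have h3 := hasDerivAt_comp_chartLine ((contMDiff_rayDir hξ).mdifferentiable hr p) v
  have h4 := ((h2 1).ofReal_comp.add ((h2 2).ofReal_comp.mul_const Complex.I)).sub
    ((h2 0).ofReal_comp.mul h3)
  have := h1.unique h4
  simpa [chartLine_zero] using this

/-- Nullity equates the squares of the time and space parts, the norm makes their sum 2, and the
future orientation picks the sign. -/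
theorem IsENormalizedNormal.time_eq_one (h : IsENormalizedNormal r F ξ) (p : M) : ξ p 0 = 1 := by
  have h1 := h.null p
  have h2 : ‖ξ p‖ ^ 2 = 2 := by rw [h.norm_eq]; norm_num
  rw [EuclideanSpace.norm_sq_eq, Fin.sum_univ_three] at h2
  simp only [Real.norm_eq_abs, sq_abs] at h2
  have h3 := h.future p
  simp only [lorentz] at h1
  nlinarith

theorem IsENormalizedNormal.space_sq (h : IsENormalizedNormal r F ξ) (p : M) :
    ξ p 1 ^ 2 + ξ p 2 ^ 2 = 1 := by
  have h1 := h.null p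
  have h2 := h.time_eq_one p
  simp only [lorentz, h2] at h1
  linarith

/-- A curve with light-like velocity of unit time component whose image is a light-like line has
constant velocity. -/
theorem velocity_const_of_isLightlikeLine {g g' : ℝ → Minkowski3} (hg : ∀ t, HasDerivAt g (g' t) t)
    (h0 : ∀ t, g' t 0 = 1) (hline : IsLightlikeLine (range g)) (s t : ℝ) :
    g' s = g' t ∧ g t = g s + (t - s) • g' s := by
  obtain ⟨x, w, hw, hnull, hx⟩ := hline
  have hw0 : w 0 ≠ 0 := by
    intro h
    simp only [lorentz, h] at hnull
    apply hw
    have h1 : w 1 = 0 := by nlinarith [sq_nonneg (w 1), sq_nonneg (w 2)]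
    have h2 : w 2 = 0 := by nlinarith [sq_nonneg (w 1), sq_nonneg (w 2)]
    ext i; fin_cases i <;> simp [h, h1, h2]
  -- Unit time speed makes the time coordinate the parameter, so it fixes the position on the line.
  have htime : ∀ t, g t 0 = g 0 0 + t := by
    intro t
    have hd : ∀ t, HasDerivAt (fun t => g t 0 - t) 0 t := fun t => by
      have := (hasDerivAt_apply_coord (hg t) 0).sub (hasDerivAt_id t)
      rw [h0, sub_self] at this
      exact this
    have := is_const_of_deriv_eq_zero (fun t => (hd t).differentiableAt) (fun t => (hd t).deriv) t 0
    simp at this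
    linarith
  have hgt : ∀ t, g t = x + ((g 0 0 + t - x 0) / w 0) • w := by
    intro t
    have : g t ∈ range fun t : ℝ => x + t • w := hx ▸ mem_range_self t
    obtain ⟨a, ha⟩ := this
    have h1 : g t 0 = x 0 + a * w 0 := by simp [← ha]
    rw [htime] at h1
    have : a = (g 0 0 + t - x 0) / w 0 := by field_simp; linarith
    rw [← this]; exact ha.symm
  have hder : ∀ t, g' t = (1 / w 0) • w := by
    intro t
    have h1 : HasDerivAt (fun t => x + ((g 0 0 + t - x 0) / w 0) • w) ((1 / w 0) • w) t := by
      have h2 : HasDerivAt (fun t : ℝ => (g 0 0 + t - x 0) / w 0) (1 / w 0) t :=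
        (((hasDerivAt_id t).const_add _).sub_const _).div_const _
      exact (h2.smul_const w).const_add x
    exact (hg t).unique (h1.congr_of_eventuallyEq (Filter.Eventually.of_forall hgt))
  refine ⟨by rw [hder, hder], ?_⟩
  rw [hgt t, hgt s, hder, smul_smul, add_assoc, ← add_smul]
  congr 2
  field_simp
  ring

theorem mem_singularSet_iff (hF : ContMDiff (𝓡 2) 𝓘(ℝ, Minkowski3) r F) (hr : r ≠ 0) (p : M) :
    p ∈ singularSet F ↔ ∃ v, v ≠ 0 ∧ diffAt Plane F p v = 0 := by
  have h : p ∈ singularSet F ↔ ¬ Injective (diffAt Plane F p) := by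
    rw [singularSet, mem_ofPred_eq, mfderiv_eq_diffAt (hF.mdifferentiable hr p)]
    rfl
  rw [h, injective_iff_map_eq_zero]
  push Not
  simp only [and_comm]

/-- Position at time zero and direction are constant along rays because the velocity is. Pairing
`dF` with the null normal `(1, ν)` cancels the `ν`-component of `dy`. The front condition becomes
the absence of a common kernel of `dτ`, `dy`, `dν`. -/
theorem exists_isRulingData [IsManifold (𝓡 2) ∞ M] (hr : r ≠ 0) (hF : IsNullWaveFront r F)
    (hL : IsLComplete r F) :
    ∃ (y ν : M → ℂ) (X : M → Plane), IsRulingData r (fun p => F p 0) y ν X ∧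
      (∀ p, F p = !₂[F p 0, (y p + F p 0 * ν p).re, (y p + F p 0 * ν p).im]) ∧
      ∀ p, p ∈ singularSet F ↔
        ∀ v, diffAt Plane y p v + F p 0 * diffAt Plane ν p v = 0 := by
  obtain ⟨α, hα, η, hη, hη0⟩ := hF
  obtain ⟨X₀, ⟨-, ξ, hξ, hX₀⟩, hcurve₀⟩ := hL
  have hFs := hα.contMDiff
  have hconormal : ∀ p v, α p (diffAt Plane F p v) = 0 := fun p v => by
    have h := hα.conormal p v
    rw [mfderiv_eq_diffAt (hFs.mdifferentiable hr p)] at h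
    exact h
  have hnormal : ∀ p v, lorentz (ξ p) (diffAt Plane F p v) = 0 := fun p v => by
    have h := hξ.normal p v
    rw [mfderiv_eq_diffAt (hFs.mdifferentiable hr p)] at h
    exact h
  have himmersion : ∀ p v, diffAt Plane F p v = 0 →
      (∃ c : ℝ, diffAt Plane α p v = c • α p) → v = 0 := fun p v h1 h2 => by
    have h := hα.immersion p v
    rw [mfderiv_eq_diffAt (hFs.mdifferentiable hr p),
      mfderiv_eq_diffAt (hα.contMDiff_conormal.mdifferentiable hr p)] at h
    exact h h1 h2
  obtain ⟨X, hX, hcurve⟩ : ∃ X : M → Plane, (∀ p, diffAt Plane F p (X p) = ξ p) ∧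
      ∀ p, ∃ γ : ℝ → M, IsMIntegralCurve (I := 𝓡 2) γ X ∧ p ∈ range γ ∧
        IsLightlikeLine (range (F ∘ γ)) := by
    refine ⟨X₀, fun p => ?_, hcurve₀⟩
    have h := hX₀ p
    rw [mfderiv_eq_diffAt (hFs.mdifferentiable hr p)] at h
    exact h
  have hξ1 := hξ.time_eq_one
  have hξ2 := hξ.space_sq
  have hder : ∀ γ : ℝ → M, IsMIntegralCurve (I := 𝓡 2) γ X → ∀ t,
      HasDerivAt (F ∘ γ) (ξ (γ t)) t := fun γ hγ t => by
    have := hasDerivAt_comp_integralCurve (E := Plane) hγ t (hFs.mdifferentiable hr (γ t))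
    rwa [hX] at this
  have hray : ∀ p, ∃ γ : ℝ → M, IsMIntegralCurve (I := 𝓡 2) γ X ∧ γ 0 = p ∧
      ∀ t, ξ (γ t) = ξ p ∧ F (γ t) = F p + t • ξ p := by
    intro p
    obtain ⟨γ, hγ, ⟨s, rfl⟩, hline⟩ := hcurve p
    have hc := velocity_const_of_isLightlikeLine (hder γ hγ) (fun t => hξ1 (γ t)) hline
    refine ⟨γ ∘ (· + s), hγ.comp_add s, by simp, fun t => ?_⟩
    exact ⟨((hc s (t + s)).1).symm, by simpa using (hc s (t + s)).2⟩
  have hdξ : ∀ p, diffAt Plane ξ p (X p) = 0 := by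
    intro p
    obtain ⟨γ, hγ, h0, h⟩ := hray p
    have h1 := hasDerivAt_comp_integralCurve (E := Plane) hγ 0
      (hξ.contMDiff.mdifferentiable hr (γ 0))
    rw [h0] at h1
    refine h1.unique ((hasDerivAt_const 0 (ξ p)).congr_of_eventuallyEq
      (Filter.Eventually.of_forall fun t => (h t).1))
  have hξ0' : ∀ p v, diffAt Plane ξ p v 0 = 0 := by
    intro p v
    have h := hasDerivAt_apply_coord
      (hasDerivAt_comp_chartLine (hξ.contMDiff.mdifferentiable hr p) v) 0
    exact h.unique ((hasDerivAt_const 0 (1 : ℝ)).congr_of_eventuallyEq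
      (Filter.Eventually.of_forall fun t => hξ1 _))
  have hξ' : ∀ p v, ξ p 1 * diffAt Plane ξ p v 1 + ξ p 2 * diffAt Plane ξ p v 2 = 0 := by
    intro p v
    have h := hasDerivAt_apply_coord
      (hasDerivAt_comp_chartLine (hξ.contMDiff.mdifferentiable hr p) v)
    have h1 := (((h 1).pow 2).add ((h 2).pow 2)).unique
      ((hasDerivAt_const 0 (1 : ℝ)).congr_of_eventuallyEq
        (Filter.Eventually.of_forall fun t => hξ2 _))
    simp [chartLine_zero] at h1
    linarith
  -- `ξ` is tangent, being `dF X`, so the null vector `η` representing `α` is orthogonal to the null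
  -- vector `ξ`. Orthogonal null vectors are proportional; the factor is the time component of `η`,
  -- which is `-α e₀`.
  have hprop : ∀ p x, α p x = -α p (EuclideanSpace.single 0 1) * lorentz (ξ p) x := by
    intro p x
    have h1 : lorentz (η p) (ξ p) = 0 := by
      rw [hη, ← hX p]; exact hconormal p (X p)
    have h2 := hη0 p
    have h3 := hξ2 p
    rw [← hη, ← hη]
    simp only [lorentz, hξ1 p] at h1 h2 ⊢
    have h4 : (η p 1 - η p 0 * ξ p 1) ^ 2 + (η p 2 - η p 0 * ξ p 2) ^ 2 = 0 := by
      linear_combination (η p 0) ^ 2 * h3 + h2 - 2 * η p 0 * h1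
    have h5 : η p 1 = η p 0 * ξ p 1 := by
      nlinarith [sq_nonneg (η p 1 - η p 0 * ξ p 1), sq_nonneg (η p 2 - η p 0 * ξ p 2)]
    have h6 : η p 2 = η p 0 * ξ p 2 := by
      nlinarith [sq_nonneg (η p 1 - η p 0 * ξ p 1), sq_nonneg (η p 2 - η p 0 * ξ p 2)]
    rw [h5, h6]
    simp
    ring
  have hαe : ∀ p, α p (EuclideanSpace.single 0 1) ≠ 0 := fun p h => hα.ne_zero p <| by
    ext x; simp [hprop p x, h]
  -- Differentiating the proportionality along `v` with `dξ v = 0` changes only the factor, so `dα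
  -- v` is a multiple of `α` and the front condition applies.
  have himm : ∀ p v, diffAt Plane F p v = 0 → diffAt Plane ξ p v = 0 → v = 0 := by
    intro p v h1 h2
    refine himmersion p v h1
      ⟨diffAt Plane α p v (EuclideanSpace.single 0 1) / α p (EuclideanSpace.single 0 1), ?_⟩
    ext x
    have hd := hasDerivAt_comp_chartLine (hα.contMDiff_conormal.mdifferentiable hr p) v
    have hd' (z : Minkowski3) : HasDerivAt (fun t => α (chartLine p v t) z) (diffAt Plane α p v z) 0 :=
      by simpa using hd.clm_apply (hasDerivAt_const 0 z)
    have he := hasDerivAt_apply_coord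
      (hasDerivAt_comp_chartLine (hξ.contMDiff.mdifferentiable hr p) v)
    rw [h2] at he
    have hl : HasDerivAt (fun t => lorentz (ξ (chartLine p v t)) x) 0 0 := by
      have := ((((he 0).mul_const (x 0)).neg).add ((he 1).mul_const (x 1))).add
        ((he 2).mul_const (x 2))
      simp only [PiLp.zero_apply, zero_mul, neg_zero, add_zero] at this
      exact this
    have hp := ((hd' (EuclideanSpace.single 0 1)).neg.mul hl)
    have hu := (hd' x).unique (hp.congr_of_eventuallyEq
      (Filter.Eventually.of_forall fun t => hprop (chartLine p v t) x))
    simp only [chartLine_zero, mul_zero, add_zero] at hu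
    rw [smul_apply, hu, smul_eq_mul, hprop p x]
    have := hαe p
    field_simp
  have hkey : ∀ p v, (diffAt Plane F p v 1 : ℂ) + diffAt Plane F p v 2 * Complex.I =
      diffAt Plane (rayPos F ξ) p v + (diffAt Plane F p v 0 * rayDir ξ p +
        F p 0 * diffAt Plane (rayDir ξ) p v) := fun p v => by
    rw [diffAt_rayPos hFs hξ.contMDiff hr]; ring
  have hFzero : ∀ p v, diffAt Plane F p v 0 = 0 →
      diffAt Plane (rayPos F ξ) p v + F p 0 * diffAt Plane (rayDir ξ) p v = 0 →
      diffAt Plane F p v = 0 := by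
    intro p v h1 h2
    have h3 := hkey p v
    rw [h1] at h3
    have h4 : (diffAt Plane F p v 1 : ℂ) + diffAt Plane F p v 2 * Complex.I = 0 := by
      rw [h3, ← h2]; simp
    have h5 := congrArg Complex.re h4
    have h6 := congrArg Complex.im h4
    simp at h5 h6
    ext i; fin_cases i <;> simp [h1, h5, h6]
  have hdata : IsRulingData r (fun p => F p 0) (rayPos F ξ) (rayDir ξ) X :=
    { smooth_time := contMDiff_coord hFs 0
      smooth_pos := contMDiff_rayPos hFs hξ.contMDiff
      smooth_dir := contMDiff_rayDir hξ.contMDiff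
      time_field := fun p => by rw [diffAt_coord hFs hr, hX, hξ1]
      pos_field := fun p => by
        rw [diffAt_rayPos hFs hξ.contMDiff hr, diffAt_rayDir hξ.contMDiff hr, hX, hdξ, hξ1]
        simp [rayDir]
      dir_field := fun p => by
        rw [diffAt_rayDir hξ.contMDiff hr, hdξ]; simp
      norm_dir := fun p => by
        rw [← sq_eq_sq₀ (norm_nonneg _) zero_le_one, Complex.sq_norm, Complex.normSq_apply]
        simp [rayDir]
        linarith [hξ2 p]
      pos_tangent := fun p v => by
        apply exists_eq_real_mul_I_mul
        · simpa [rayDir] using hξ2 p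
        · have h2 := hnormal p v
          have h3 := hξ' p v
          have h4 := hξ2 p
          rw [diffAt_rayPos hFs hξ.contMDiff hr, diffAt_rayDir hξ.contMDiff hr]
          simp only [lorentz, hξ1] at h2
          simp [rayDir]
          linear_combination h2 - F p 0 * h3 - (diffAt Plane F p v 0) * h4
      dir_tangent := fun p v => by
        apply exists_eq_real_mul_I_mul
        · simpa [rayDir] using hξ2 p
        · rw [diffAt_rayDir hξ.contMDiff hr]
          simpa [rayDir] using hξ' p v
      immersion := fun p v h1 h2 h3 => by
        rw [diffAt_coord hFs hr] at h1
        refine himm p v (hFzero p v h1 (by rw [h2, h3]; simp)) ?_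
        rw [diffAt_rayDir hξ.contMDiff hr] at h3
        have h5 := congrArg Complex.re h3
        have h6 := congrArg Complex.im h3
        simp at h5 h6
        ext i; fin_cases i <;> simp [hξ0', h5, h6]
      ray := fun p => by
        obtain ⟨γ, hγ, h0, h⟩ := hray p
        refine ⟨γ, hγ, h0, fun t => ?_⟩
        obtain ⟨h1, h2⟩ := h t
        have h3 : rayDir ξ (γ t) = rayDir ξ p := by simp [rayDir, h1]
        refine ⟨by simp [h2, hξ1], ?_, h3⟩
        simp only [rayPos, h3, h2]
        simp [hξ1, rayDir]
        ring }
  refine ⟨rayPos F ξ, rayDir ξ, X, hdata, fun p => ?_, fun p => ?_⟩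
  · ext i; fin_cases i <;> simp [rayPos]
  -- A null direction of `dF` is killed by `dτ`, hence is transverse to `X`. Since `dy + τ dν`
  -- already kills `X`, it vanishes as soon as it kills that direction.
  · have hspan := exists_span_of_apply_eq_one (by simp) _ (hdata.time_field p)
    constructor
    · intro hp v
      obtain ⟨w, hw, hFw⟩ := (mem_singularSet_iff hFs hr p).1 hp
      have hk := hkey p w
      simp only [hFw, PiLp.zero_apply, Complex.ofReal_zero, zero_mul, zero_add] at hk
      obtain ⟨b, hb⟩ := hspan.2 w hw (by rw [diffAt_coord hFs hr, hFw]; rfl) v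
      rw [hb]
      simp only [map_add, map_smul, hdata.pos_field, hdata.dir_field, smul_zero, zero_add]
      rw [mul_smul_comm, ← smul_add, ← hk, smul_zero]
    · intro h
      obtain ⟨v, hv, hv0⟩ := hspan.1
      exact (mem_singularSet_iff hFs hr p).2
        ⟨v, hv, hFzero p v (by rwa [diffAt_coord hFs hr] at hv0) (h v)⟩

end NullData

/-! ### Local product structure along the rays and focal times. -/

section LocalStructure

variable {M : Type*} [TopologicalSpace M] [ChartedSpace Plane M]
  {r : WithTop ℕ∞} {τ : M → ℝ} {y ν : M → ℂ} {X : M → Plane}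

theorem diffAt_clm_comp {E E₁ E₂ : Type*} [NormedAddCommGroup E] [NormedSpace ℝ E]
    [NormedAddCommGroup E₁] [NormedSpace ℝ E₁] [NormedAddCommGroup E₂] [NormedSpace ℝ E₂]
    {M : Type*} [TopologicalSpace M] [ChartedSpace E M] (L : E₁ →L[ℝ] E₂) {f : M → E₁} {p : M}
    (hf : MDifferentiableAt 𝓘(ℝ, E) 𝓘(ℝ, E₁) f p) (v : E) :
    diffAt E (fun q => L (f q)) p v = L (diffAt E f p v) := by
  have h := L.hasFDerivAt.comp_hasDerivAt (0 : ℝ) (hasDerivAt_comp_chartLine hf v)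
  have h2 : MDifferentiableAt 𝓘(ℝ, E) 𝓘(ℝ, E₂) (fun q => L (f q)) p :=
    L.differentiable.mdifferentiable.mdifferentiableAt.comp p hf
  exact (hasDerivAt_comp_chartLine h2 v).unique h

theorem diffAt_prodMk {E E₁ E₂ : Type*} [NormedAddCommGroup E] [NormedSpace ℝ E]
    [NormedAddCommGroup E₁] [NormedSpace ℝ E₁] [NormedAddCommGroup E₂] [NormedSpace ℝ E₂]
    {M : Type*} [TopologicalSpace M] [ChartedSpace E M] {f : M → E₁} {g : M → E₂} {p : M}
    (hf : MDifferentiableAt 𝓘(ℝ, E) 𝓘(ℝ, E₁) f p) (hg : MDifferentiableAt 𝓘(ℝ, E) 𝓘(ℝ, E₂) g p)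
    (v : E) :
    diffAt E (fun q => (f q, g q)) p v = (diffAt E f p v, diffAt E g p v) :=
  (hasDerivAt_comp_chartLine (hf.prodMk_space hg) v).unique
    ((hasDerivAt_comp_chartLine hf v).prodMk (hasDerivAt_comp_chartLine hg v))

namespace IsRulingData

variable (h : IsRulingData r τ y ν X)
include h

theorem span (p : M) : (∃ v, v ≠ 0 ∧ diffAt Plane τ p v = 0) ∧ ∀ v, v ≠ 0 →
    diffAt Plane τ p v = 0 → ∀ u, ∃ b : ℝ, u = diffAt Plane τ p u • X p + b • v :=
  exists_span_of_apply_eq_one (by simp) _ (h.time_field p)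

/-- Two vectors with the same images under `dτ` and a nonzero `df` that kills `X` are equal. -/
theorem eq_zero_of_diffAt {E' : Type*} [NormedAddCommGroup E'] [NormedSpace ℝ E'] {p : M}
    {A : Plane →L[ℝ] E'} (hX : A (X p) = 0) (hA : A ≠ 0) {v : Plane}
    (h1 : diffAt Plane τ p v = 0) (h2 : A v = 0) : v = 0 := by
  by_contra hv
  apply hA
  ext u
  obtain ⟨b, hb⟩ := (h.span p).2 v hv h1 u
  rw [hb]
  simp [hX, h2]

/-- A nonzero vector in `ker dτ` is not killed by both `dy` and `dν`, so a real or imaginary part of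
`y` or `ν` serves as the transverse coordinate. -/
theorem exists_transversal (hr : r ≠ 0) (q : M) : ∃ w : M → ℝ, ContMDiff (𝓡 2) 𝓘(ℝ, ℝ) r w ∧
    (∀ p, diffAt Plane w p (X p) = 0) ∧ diffAt Plane w q ≠ 0 := by
  obtain ⟨v, hv, hv0⟩ := (h.span q).1
  have key : ∀ f : M → ℂ, ContMDiff (𝓡 2) 𝓘(ℝ, ℂ) r f → (∀ p, diffAt Plane f p (X p) = 0) →
      diffAt Plane f q v ≠ 0 → ∃ w : M → ℝ, ContMDiff (𝓡 2) 𝓘(ℝ, ℝ) r w ∧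
        (∀ p, diffAt Plane w p (X p) = 0) ∧ diffAt Plane w q ≠ 0 := by
    intro f hf hfX hfv
    have hL : ∀ L : ℂ →L[ℝ] ℝ, L (diffAt Plane f q v) ≠ 0 → ∃ w : M → ℝ,
        ContMDiff (𝓡 2) 𝓘(ℝ, ℝ) r w ∧ (∀ p, diffAt Plane w p (X p) = 0) ∧
          diffAt Plane w q ≠ 0 := fun L hLv => by
      refine ⟨fun p => L (f p), L.contMDiff.comp hf, fun p => ?_, fun h0 => hLv ?_⟩
      · rw [diffAt_clm_comp L (hf.mdifferentiable hr p), hfX, map_zero]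
      · rw [← diffAt_clm_comp L (hf.mdifferentiable hr q), h0]; rfl
    by_cases hre : (diffAt Plane f q v).re = 0
    · refine hL Complex.imCLM fun him => hfv (Complex.ext hre him)
    · exact hL Complex.reCLM hre
  by_cases hν : diffAt Plane ν q v = 0
  · by_cases hy : diffAt Plane y q v = 0
    · exact absurd (h.immersion q v hv0 hy hν) hv
    · exact key y h.smooth_pos h.pos_field hy
  · exact key ν h.smooth_dir h.dir_field hν

/-- Near each point, the functions that are constant along the rays are functions of a single
coordinate `w`. -/
theorem exists_local_factor [IsManifold (𝓡 2) r M] (hr : 1 ≤ r) (q : M) :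
    ∃ (w : M → ℝ) (U : Set M) (O : Set ℝ), ContMDiff (𝓡 2) 𝓘(ℝ, ℝ) r w ∧
      (∀ p, diffAt Plane w p (X p) = 0) ∧ IsOpen U ∧ q ∈ U ∧ IsOpen O ∧ (∀ p ∈ U, w p ∈ O) ∧
      (∀ p ∈ U, diffAt Plane w p ≠ 0) ∧
      ∀ f : M → ℂ, ContMDiff (𝓡 2) 𝓘(ℝ, ℂ) r f → (∀ p, diffAt Plane f p (X p) = 0) →
        ∃ k : ℝ → ℂ, ContDiffOn ℝ r k O ∧ (∀ p ∈ U, f p = k (w p)) ∧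
          ∀ p ∈ U, ∀ v, diffAt Plane f p v = diffAt Plane w p v • deriv k (w p) := by
  have hr0 : r ≠ 0 := by rintro rfl; simp at hr
  obtain ⟨w, hw, hwX, hwq⟩ := h.exists_transversal hr0 q
  have hτd := h.smooth_time.mdifferentiable hr0
  have hwd := hw.mdifferentiable hr0
  let g : M → ℝ × ℝ := fun p => (τ p, w p)
  have hg : ContMDiff (𝓡 2) 𝓘(ℝ, ℝ × ℝ) r g := h.smooth_time.prodMk_space hw
  have hDg : ∀ p v, diffAt Plane g p v = (diffAt Plane τ p v, diffAt Plane w p v) := fun p v =>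
    diffAt_prodMk (hτd p) (hwd p) v
  have hinj : Injective (diffAt Plane g q) := by
    rw [injective_iff_map_eq_zero]
    intro v hv
    rw [hDg, Prod.mk_eq_zero] at hv
    exact h.eq_zero_of_diffAt (hwX q) hwq hv.1 hv.2
  obtain ⟨e, hqe, heg⟩ := isLocalDiffeomorphAt_of_injective_mfderiv (E := Plane) hr (by simp)
    isOpen_univ hg.contMDiffOn (mem_univ q) hinj
  have heg' : ∀ p ∈ e.source, e p = g p := fun p hp => (heg hp).symm
  have hsymm : ∀ z ∈ e.target, g (e.symm z) = z := fun z hz =>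
    (heg' _ (e.map_target hz)).symm.trans (e.right_inv hz)
  have hsd : ∀ z ∈ e.target, MDifferentiableAt 𝓘(ℝ, ℝ × ℝ) (𝓡 2) e.symm z := fun z hz =>
    e.symm.mdifferentiableAt hr0 hz
  have hDid : ∀ z ∈ e.target, ∀ u,
      diffAt Plane g (e.symm z) (diffTo Plane e.symm z u) = u := by
    intro z hz u
    have h1 := hasFDerivAt_comp_diffTo (hsd z hz) (hg.mdifferentiable hr0 (e.symm z))
    have h2 : HasFDerivAt (g ∘ e.symm) (ContinuousLinearMap.id ℝ (ℝ × ℝ)) z :=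
      (hasFDerivAt_id z).congr_of_eventuallyEq
        (Filter.eventuallyEq_of_mem (e.open_target.mem_nhds hz) hsymm)
    have := congrArg (fun L : ℝ × ℝ →L[ℝ] ℝ × ℝ => L u) (h1.unique h2)
    simpa using this
  have hw0 : ∀ z ∈ e.target, diffAt Plane w (e.symm z) ≠ 0 := by
    intro z hz h0
    have := hDid z hz (0, 1)
    rw [hDg, h0] at this
    simp at this
  -- In the coordinates `(τ, w)` the field `X` is the coordinate field of `τ`.
  have hXd : ∀ z ∈ e.target, diffTo Plane e.symm z (1, 0) = X (e.symm z) := by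
    intro z hz
    have h1 := hDid z hz (1, 0)
    rw [hDg, Prod.mk.injEq] at h1
    refine sub_eq_zero.1 (h.eq_zero_of_diffAt (hwX _) (hw0 z hz) ?_ ?_)
    · rw [map_sub, h1.1, h.time_field, sub_self]
    · rw [map_sub, h1.2, hwX, sub_zero]
  have hqt : g q ∈ e.target := by rw [← heg' q hqe]; exact e.map_source hqe
  -- A ball of the sup metric is a box: the ray segments in it are connected and all reach the slice
  -- `τ = τ q`, on which `k` is read off.
  obtain ⟨ε, hε, hball⟩ := Metric.isOpen_iff.1 e.open_target (g q) hqt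
  let U : Set M := e.source ∩ g ⁻¹' Metric.ball (g q) ε
  have hU : IsOpen U := e.open_source.inter (Metric.isOpen_ball.preimage hg.continuous)
  have hmem : ∀ t u, t ∈ Metric.ball (τ q) ε → u ∈ Metric.ball (w q) ε → (t, u) ∈ e.target := by
    intro t u ht hu
    refine hball ?_
    rw [← ball_prod_same]
    exact ⟨ht, hu⟩
  have hUmem : ∀ p ∈ U, τ p ∈ Metric.ball (τ q) ε ∧ w p ∈ Metric.ball (w q) ε := by
    intro p hp
    have := hp.2
    rw [mem_preimage, ← ball_prod_same] at this
    exact this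
  have heinv : ∀ p ∈ U, e.symm (τ p, w p) = p := by
    intro p hp
    have : e p = (τ p, w p) := heg' p hp.1
    rw [← this]; exact e.left_inv hp.1
  refine ⟨w, U, Metric.ball (w q) ε, hw, hwX, hU, ⟨hqe, Metric.mem_ball_self hε⟩,
    Metric.isOpen_ball, fun p hp => (hUmem p hp).2, fun p hp => ?_, fun f hf hfX => ?_⟩
  · have := hw0 (τ p, w p) (hmem _ _ (hUmem p hp).1 (hUmem p hp).2)
    rwa [heinv p hp] at this
  have hk : ContDiffOn ℝ r (fun u => f (e.symm (τ q, u))) (Metric.ball (w q) ε) := by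
    have h1 : ContDiffOn ℝ r (f ∘ e.symm) e.target :=
      (hf.comp_contMDiffOn e.contMDiffOn_invFun).contDiffOn
    exact h1.comp (g := f ∘ e.symm) (f := fun u => (τ q, u)) (by fun_prop)
      fun u hu => hmem _ _ (Metric.mem_ball_self hε) hu
  have hfk : ∀ p ∈ U, f p = f (e.symm (τ q, w p)) := by
    intro p hp
    obtain ⟨h1, h2⟩ := hUmem p hp
    have hd : ∀ t ∈ Metric.ball (τ q) ε, HasDerivAt (fun t => f (e.symm (t, w p))) 0 t := by
      intro t ht
      have hz := hmem t (w p) ht h2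
      have h3 := hasFDerivAt_comp_diffTo (hsd _ hz) (hf.mdifferentiable hr0 (e.symm (t, w p)))
      have h4 : HasDerivAt (fun t : ℝ => (t, w p)) (1, 0) t :=
        (hasDerivAt_id t).prodMk (hasDerivAt_const t (w p))
      have h5 := h3.comp_hasDerivAt (f := fun t : ℝ => (t, w p)) t h4
      rw [ContinuousLinearMap.comp_apply, hXd _ hz, hfX] at h5
      exact h5
    have := Metric.isOpen_ball.is_const_of_deriv_eq_zero (convex_ball (τ q) ε).isPreconnected
      (fun t ht => (hd t ht).differentiableAt.differentiableWithinAt)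
      (fun t ht => (hd t ht).deriv) h1 (Metric.mem_ball_self hε)
    simpa only [heinv p hp] using this
  refine ⟨_, hk, hfk, fun p hp v => ?_⟩
  have hkd := ((hk.contDiffAt (Metric.isOpen_ball.mem_nhds (hUmem p hp).2)).differentiableAt
    hr0).hasDerivAt
  have h1 := hasDerivAt_comp_chartLine (hwd p) v
  have h2 := HasDerivAt.scomp_of_eq (0 : ℝ) hkd h1 (by simp [chartLine_zero])
  have hev : ∀ᶠ t in 𝓝 (0 : ℝ), chartLine p v t ∈ U :=
    (continuousAt_chartLine p v).eventually_mem (by rw [chartLine_zero]; exact hU.mem_nhds hp)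
  refine (hasDerivAt_comp_chartLine (hf.mdifferentiable hr0 p) v).unique
    (h2.congr_of_eventuallyEq ?_)
  filter_upwards [hev] with t ht
  exact hfk _ ht

/-- Along a ray, the differential of a function that is constant along the rays vanishes
everywhere or nowhere. -/
theorem diffAt_eq_zero_of_ray [IsManifold (𝓡 2) r M] (hr : 1 ≤ r) {f : M → ℂ}
    (hf : ContMDiff (𝓡 2) 𝓘(ℝ, ℂ) r f) (hfX : ∀ p, diffAt Plane f p (X p) = 0) {γ : ℝ → M}
    (hγ : IsMIntegralCurve (I := 𝓡 2) γ X) {s : ℝ} (hs : diffAt Plane f (γ s) = 0) (t : ℝ) :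
    diffAt Plane f (γ t) = 0 := by
  have hr0 : r ≠ 0 := by rintro rfl; simp at hr
  have hloc : ∀ t₀, ∀ᶠ t in 𝓝 t₀, (diffAt Plane f (γ t) = 0 ↔ diffAt Plane f (γ t₀) = 0) := by
    intro t₀
    obtain ⟨w, U, O, hw, hwX, hU, hqU, hO, hUO, hw0, hfac⟩ := h.exists_local_factor hr (γ t₀)
    obtain ⟨k, hk, -, hdk⟩ := hfac f hf hfX
    -- The coordinate `w` is constant along the ray, so inside `U` the vanishing of `df` is decided
    -- by the single number `k' (w (γ t₀))`.
    have hwγ : ∀ t, w (γ t) = w (γ t₀) := by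
      have hd : ∀ t, HasDerivAt (w ∘ γ) 0 t := fun t => by
        have := hasDerivAt_comp_integralCurve (E := Plane) hγ t (hw.mdifferentiable hr0 (γ t))
        rwa [hwX] at this
      exact fun t => is_const_of_deriv_eq_zero (fun t => (hd t).differentiableAt)
        (fun t => (hd t).deriv) t t₀
    have hz : ∀ t, γ t ∈ U → (diffAt Plane f (γ t) = 0 ↔ deriv k (w (γ t₀)) = 0) := by
      intro t ht
      constructor
      · intro h0
        by_contra hne
        apply hw0 _ ht
        ext v
        have := hdk _ ht v
        rw [h0, hwγ] at this
        simpa [hne] using this.symm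
      · intro h0
        ext v
        rw [hdk _ ht v, hwγ, h0]
        simp
    have hc : ContinuousAt γ t₀ := (hγ t₀).1
    filter_upwards [hc.eventually_mem (hU.mem_nhds hqU)] with t ht
    rw [hz t ht, hz t₀ hqU]
  have hclopen : IsClopen {t | diffAt Plane f (γ t) = 0} := by
    constructor
    · rw [← isOpen_compl_iff, isOpen_iff_mem_nhds]
      intro t₀ ht₀
      filter_upwards [hloc t₀] with t ht h0
      exact ht₀ (ht.1 h0)
    · rw [isOpen_iff_mem_nhds]
      intro t₀ ht₀
      filter_upwards [hloc t₀] with t ht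
      exact ht.2 ht₀
  have := hclopen.eq_univ ⟨s, hs⟩
  exact (this ▸ mem_univ t : t ∈ {t | diffAt Plane f (γ t) = 0})

/-- Both differentials kill `X` and take values in the real line spanned by `iν`. On `ker dτ` they
reduce to two real numbers `a` and `b`, with `b ≠ 0`, and `T = -a / b`. -/
theorem exists_focal_time {p : M} (hp : diffAt Plane ν p ≠ 0) :
    ∃ T : ℝ, ∀ v, diffAt Plane y p v + T * diffAt Plane ν p v = 0 := by
  obtain ⟨v, hv, hv0⟩ := (h.span p).1
  obtain ⟨a, ha⟩ := h.pos_tangent p v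
  obtain ⟨b, hb⟩ := h.dir_tangent p v
  have hb0 : b ≠ 0 := by
    rintro rfl
    exact hv (h.eq_zero_of_diffAt (h.dir_field p) hp hv0 (by simp [hb]))
  refine ⟨-a / b, fun u => ?_⟩
  obtain ⟨c, hc⟩ := (h.span p).2 v hv hv0 u
  have : (b : ℂ) ≠ 0 := by exact_mod_cast hb0
  rw [hc, map_add, map_add, map_smul, map_smul, map_smul, map_smul, h.pos_field, h.dir_field, ha, hb]
  simp only [smul_zero, zero_add, Complex.real_smul]
  push_cast
  field_simp
  ring

theorem dir_ne_zero_of_focal {p : M} {T : ℝ}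
    (hp : ∀ v, diffAt Plane y p v + T * diffAt Plane ν p v = 0) : diffAt Plane ν p ≠ 0 := by
  intro h0
  obtain ⟨v, hv, hv0⟩ := (h.span p).1
  have h1 := hp v
  rw [h0] at h1
  exact hv (h.immersion p v hv0 (by simpa using h1) (by simp [h0]))

/-- For fixed `T` the function `y + T ν` is constant along rays, so its differential vanishes along
a whole ray or nowhere on it. -/
theorem focal_of_ray [IsManifold (𝓡 2) r M] (hr : 1 ≤ r) {γ : ℝ → M}
    (hγ : IsMIntegralCurve (I := 𝓡 2) γ X) {T s : ℝ}
    (hs : ∀ v, diffAt Plane y (γ s) v + T * diffAt Plane ν (γ s) v = 0) (t : ℝ) :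
    ∀ v, diffAt Plane y (γ t) v + T * diffAt Plane ν (γ t) v = 0 := by
  have hr0 : r ≠ 0 := by rintro rfl; simp at hr
  have hf : ContMDiff (𝓡 2) 𝓘(ℝ, ℂ) r (fun p => y p + T * ν p) := by
    have : ContDiff ℝ r (fun z : ℂ × ℂ => z.1 + T * z.2) :=
      contDiff_fst.add (contDiff_const.mul contDiff_snd)
    exact this.comp_contMDiff (h.smooth_pos.prodMk_space h.smooth_dir)
  have hdf : ∀ p v, diffAt Plane (fun p => y p + T * ν p) p v =
      diffAt Plane y p v + T * diffAt Plane ν p v := fun p v =>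
    (hasDerivAt_comp_chartLine (hf.mdifferentiable hr0 p) v).unique
      ((hasDerivAt_comp_chartLine (h.smooth_pos.mdifferentiable hr0 p) v).add
        ((hasDerivAt_comp_chartLine (h.smooth_dir.mdifferentiable hr0 p) v).const_mul _))
  intro v
  rw [← hdf, h.diffAt_eq_zero_of_ray hr hf (fun p => by simp [hdf, h.pos_field, h.dir_field]) hγ
    (s := s) (by ext v; rw [hdf, hs]; rfl) t]
  rfl

theorem exists_focal_point [IsManifold (𝓡 2) r M] (hr : 1 ≤ r) {γ : ℝ → M}
    (hγ : IsMIntegralCurve (I := 𝓡 2) γ X) {p : M} (h0 : γ 0 = p) (hτ : ∀ t, τ (γ t) = τ p + t)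
    {T : ℝ} (hp : ∀ v, diffAt Plane y p v + T * diffAt Plane ν p v = 0) :
    ∀ v, diffAt Plane y (γ (T - τ p)) v + τ (γ (T - τ p)) * diffAt Plane ν (γ (T - τ p)) v = 0 := by
  have hT : τ (γ (T - τ p)) = T := by rw [hτ]; ring
  rw [hT]
  exact h.focal_of_ray hr hγ (s := 0) (by rwa [h0]) _

/-- The ray is defined for all times, so it reaches its focal time at an actual focal point, where
the bound `C` applies. -/
theorem abs_focal_time_le [IsManifold (𝓡 2) r M] (hr : 1 ≤ r) {C : ℝ}
    (hC : ∀ p, (∀ v, diffAt Plane y p v + τ p * diffAt Plane ν p v = 0) → |τ p| ≤ C) {p : M} {T : ℝ}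
    (hp : ∀ v, diffAt Plane y p v + T * diffAt Plane ν p v = 0) : |T| ≤ C := by
  obtain ⟨γ, hγ, h0, hray⟩ := h.ray p
  have := hC _ (h.exists_focal_point hr hγ h0 (fun t => (hray t).1) hp)
  rw [(hray _).1] at this
  simpa using this

/-- If the focal points stay at bounded time, the rays that meet a focal point fill an open and
closed set. -/
theorem isClopen_dir_ne_zero [IsManifold (𝓡 2) r M] (hr : 1 ≤ r) {C : ℝ}
    (hC : ∀ p, (∀ v, diffAt Plane y p v + τ p * diffAt Plane ν p v = 0) → |τ p| ≤ C) :
    IsClopen {p | diffAt Plane ν p ≠ 0} := by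
  have hr0 : r ≠ 0 := by rintro rfl; simp at hr
  have hderiv : ∀ (q : M), ∃ (w : M → ℝ) (U : Set M) (ky kν : ℝ → ℂ),
      IsOpen U ∧ q ∈ U ∧ ContinuousAt (fun p => deriv ky (w p)) q ∧
      ContinuousAt (fun p => deriv kν (w p)) q ∧ (∀ p ∈ U, diffAt Plane w p ≠ 0) ∧
      (∀ p ∈ U, ∀ v, diffAt Plane y p v = diffAt Plane w p v • deriv ky (w p)) ∧
      (∀ p ∈ U, ∀ v, diffAt Plane ν p v = diffAt Plane w p v • deriv kν (w p)) := by
    intro q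
    obtain ⟨w, U, O, hw, hwX, hU, hqU, hO, hUO, hw0, hfac⟩ := h.exists_local_factor hr q
    obtain ⟨ky, hky, -, hdy⟩ := hfac y h.smooth_pos h.pos_field
    obtain ⟨kν, hkν, -, hdν⟩ := hfac ν h.smooth_dir h.dir_field
    have hc : ∀ k : ℝ → ℂ, ContDiffOn ℝ r k O → ContinuousAt (fun p => deriv k (w p)) q :=
      fun k hk => ContinuousAt.comp (g := deriv k)
        ((hk.continuousOn_deriv_of_isOpen hO hr).continuousAt (hO.mem_nhds (hUO q hqU)))
        hw.continuous.continuousAt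
    exact ⟨w, U, ky, kν, hU, hqU, hc ky hky, hc kν hkν, hw0, hdy, hdν⟩
  have hiff : ∀ {w : M → ℝ} {k : ℝ → ℂ} {p : M} {f : M → ℂ}, diffAt Plane w p ≠ 0 →
      (∀ v, diffAt Plane f p v = diffAt Plane w p v • deriv k (w p)) →
      (diffAt Plane f p = 0 ↔ deriv k (w p) = 0) := by
    intro w k p f hw hf
    constructor
    · intro h0
      by_contra hne
      apply hw
      ext v
      have := hf v
      rw [h0] at this
      simpa [hne] using this.symm
    · intro h0
      ext v
      rw [hf, h0]
      simp
  constructor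
  · rw [← isOpen_compl_iff, isOpen_iff_mem_nhds]
    intro q hq
    have hq0 : diffAt Plane ν q = 0 := by simpa using hq
    obtain ⟨w, U, ky, kν, hU, hqU, hcy, hcν, hw0, hdy, hdν⟩ := hderiv q
    have hkν : deriv kν (w q) = 0 := (hiff (hw0 q hqU) (hdν q hqU)).1 hq0
    have hky : deriv ky (w q) ≠ 0 := by
      intro h0
      have hy0 := (hiff (hw0 q hqU) (hdy q hqU)).2 h0
      obtain ⟨v, hv, hv0⟩ := (h.span q).1
      exact hv (h.immersion q v hv0 (by simp [hy0]) (by simp [hq0]))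
    -- Near a ray with `dν = 0` the derivative of `y` stays away from zero while that of `ν` is
    -- small. A focal time bounded by `C` would give `|y'| = |T| |ν'| ≤ C |ν'|`.
    have hev : ∀ᶠ p in 𝓝 q, C * ‖deriv kν (w p)‖ < ‖deriv ky (w p)‖ := by
      have h1 : ContinuousAt (fun p => C * ‖deriv kν (w p)‖) q := hcν.norm.const_mul C
      refine h1.eventually_lt hcy.norm ?_
      simp [hkν, hky]
    filter_upwards [hU.mem_nhds hqU, hev] with p hp hlt hpν
    obtain ⟨T, hT⟩ := h.exists_focal_time hpν
    have hTC := h.abs_focal_time_le hr hC hT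
    obtain ⟨v, hv⟩ : ∃ v, diffAt Plane w p v ≠ 0 := by
      by_contra! hcon
      exact hw0 p hp (by ext v; simp [hcon v])
    have h1 := hT v
    rw [hdy p hp, hdν p hp, mul_smul_comm, ← smul_add, smul_eq_zero, or_iff_right hv] at h1
    have h2 : ‖deriv ky (w p)‖ = |T| * ‖deriv kν (w p)‖ := by
      rw [eq_neg_of_add_eq_zero_left h1, norm_neg, norm_mul, Complex.norm_real, Real.norm_eq_abs]
    have := mul_le_mul_of_nonneg_right hTC (norm_nonneg (deriv kν (w p)))
    linarith
  · rw [isOpen_iff_mem_nhds]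
    intro q hq
    obtain ⟨w, U, ky, kν, hU, hqU, hcy, hcν, hw0, hdy, hdν⟩ := hderiv q
    have hkν : deriv kν (w q) ≠ 0 := fun h0 => hq ((hiff (hw0 q hqU) (hdν q hqU)).2 h0)
    filter_upwards [hU.mem_nhds hqU, hcν.eventually_ne hkν] with p hp hne h0
    exact hne ((hiff (hw0 p hp) (hdν p hp)).1 h0)

end IsRulingData

end LocalStructure

/-! ### The analytic four vertex theorem. -/

section FourVertex

/-- The mean value theorem supplies a point of nonpositive derivative, and the derivative changes
sign between it and `x`. The zero is not `x`, which keeps it off the endpoints. -/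
theorem exists_deriv_eq_zero_of_le {R : ℝ → ℝ} (hR : ContDiff ℝ 1 R) {p q x : ℝ} (hpq : p < q)
    (hle : R q ≤ R p) (hx : x ∈ Icc p q) (hpos : 0 < deriv R x) :
    ∃ z ∈ Ioo p q, deriv R z = 0 := by
  obtain ⟨c, hc, hdc⟩ := exists_deriv_eq_slope R hpq hR.continuous.continuousOn
    (hR.differentiable one_ne_zero).differentiableOn
  have hc0 : deriv R c ≤ 0 := by
    rw [hdc]; exact div_nonpos_of_nonpos_of_nonneg (by linarith) (by linarith)
  have hcont : Continuous (deriv R) := hR.continuous_deriv le_rfl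
  obtain ⟨z, hz, hz0⟩ := intermediate_value_uIcc (a := c) (b := x) hcont.continuousOn
    (show (0 : ℝ) ∈ uIcc (deriv R c) (deriv R x) from mem_uIcc.2 (Or.inl ⟨hc0, hpos.le⟩))
  have hzx : z ≠ x := by rintro rfl; linarith
  refine ⟨z, ?_, hz0⟩
  rcases mem_uIcc.1 hz with h | h
  · exact ⟨hc.1.trans_le h.1, (lt_of_le_of_ne h.2 hzx).trans_le hx.2⟩
  · exact ⟨hx.1.trans_lt (lt_of_le_of_ne h.1 hzx.symm), h.2.trans_lt hc.2⟩

theorem exists_deriv_eq_zero_of_ge {R : ℝ → ℝ} (hR : ContDiff ℝ 1 R) {p q x : ℝ} (hpq : p < q)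
    (hle : R p ≤ R q) (hx : x ∈ Icc p q) (hneg : deriv R x < 0) :
    ∃ z ∈ Ioo p q, deriv R z = 0 := by
  obtain ⟨z, hz, h⟩ := exists_deriv_eq_zero_of_le (R := fun s => -R s) hR.neg hpq
    (neg_le_neg hle) hx (by rw [deriv.fun_neg]; linarith)
  exact ⟨z, hz, by rw [deriv.fun_neg] at h; linarith⟩

/-- Zeros found in a period starting at `a` are moved to the standard period by reduction modulo
`ℓ`, which is injective on a half-open period. -/
theorem encard_le_of_strictMono {P : ℝ → Prop} {ℓ a : ℝ} (hℓ : 0 < ℓ)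
    (hP : ∀ s, P s → ∀ k : ℤ, P (s - k * ℓ)) {n : ℕ} {z : Fin n → ℝ}
    (hz : StrictMono z) (hza : ∀ i, z i ∈ Ico a (a + ℓ)) (hzP : ∀ i, P (z i)) :
    (n : ℕ∞) ≤ {s | s ∈ Ico 0 ℓ ∧ P s}.encard := by
  have hinj : Injective (fun i => toIcoMod hℓ 0 (z i)) := by
    intro i j hij
    apply hz.injective
    have h1 : toIcoMod hℓ a (toIcoMod hℓ 0 (z i)) = toIcoMod hℓ a (toIcoMod hℓ 0 (z j)) :=
      congrArg _ hij
    rw [toIcoMod_toIcoMod, toIcoMod_toIcoMod, (toIcoMod_eq_self hℓ).2 (hza i),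
      (toIcoMod_eq_self hℓ).2 (hza j)] at h1
    exact h1
  have hcard := hinj.encard_range
  rw [ENat.card_eq_coe_fintype_card, Fintype.card_fin] at hcard
  refine hcard.trans (encard_le_encard ?_)
  rintro _ ⟨i, rfl⟩
  refine ⟨by simpa using toIcoMod_mem_Ico hℓ 0 (z i), ?_⟩
  have := hP _ (hzP i) (toIcoDiv hℓ 0 (z i))
  rw [← zsmul_eq_mul] at this
  exact this

/-- Integration by parts: `R` is orthogonal to every translate of `sin`, and the boundary terms
cancel by periodicity. -/
theorem integral_deriv_mul_cos_sub {R : ℝ → ℝ} (hR : ContDiff ℝ 1 R)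
    (hper : Periodic R (2 * Real.pi))
    (hcos : ∫ s in (0 : ℝ)..(2 * Real.pi), R s * Real.cos s = 0)
    (hsin : ∫ s in (0 : ℝ)..(2 * Real.pi), R s * Real.sin s = 0) (a m : ℝ) :
    ∫ s in a..(a + 2 * Real.pi), deriv R s * Real.cos (s - m) = 0 := by
  have hsh : ∀ g : ℝ → ℝ, Periodic g (2 * Real.pi) →
      ∫ s in a..(a + 2 * Real.pi), g s = ∫ s in (0 : ℝ)..(2 * Real.pi), g s := fun g hg => by
    simpa using hg.intervalIntegral_add_eq a 0
  have hc : ∫ s in a..(a + 2 * Real.pi), R s * Real.cos s = 0 := by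
    rw [hsh _ (fun s => by rw [hper, Real.cos_add_two_pi]), hcos]
  have hs : ∫ s in a..(a + 2 * Real.pi), R s * Real.sin s = 0 := by
    rw [hsh _ (fun s => by rw [hper, Real.sin_add_two_pi]), hsin]
  have hRc := hR.continuous
  have hparts := intervalIntegral.integral_deriv_mul_eq_sub (a := a) (b := a + 2 * Real.pi)
    (u := R) (v := fun s => Real.cos (s - m)) (u' := deriv R) (v' := fun s => -Real.sin (s - m))
    (fun s _ => (hR.differentiable one_ne_zero s).hasDerivAt)
    (fun s _ => by simpa using ((hasDerivAt_id s).sub_const m).cos)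
    ((hR.continuous_deriv le_rfl).intervalIntegrable _ _)
    ((by fun_prop : Continuous fun s => -Real.sin (s - m)).intervalIntegrable _ _)
  have hsplit : ∫ s in a..(a + 2 * Real.pi), R s * -Real.sin (s - m) = 0 := by
    have : ∀ s, R s * -Real.sin (s - m) =
        Real.sin m * (R s * Real.cos s) - Real.cos m * (R s * Real.sin s) := fun s => by
      rw [Real.sin_sub]; ring
    simp_rw [this]
    rw [intervalIntegral.integral_sub, intervalIntegral.integral_const_mul,
      intervalIntegral.integral_const_mul, hc, hs]
    · simp
    · exact (by fun_prop : Continuous _).intervalIntegrable _ _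
    · exact (by fun_prop : Continuous _).intervalIntegrable _ _
  rw [intervalIntegral.integral_add] at hparts
  · rw [hsplit, add_zero] at hparts
    rw [hparts, hper, show a + 2 * Real.pi - m = a - m + 2 * Real.pi by ring,
      Real.cos_add_two_pi, sub_self]
  · exact ((hR.continuous_deriv le_rfl).mul (by fun_prop)).intervalIntegrable _ _
  · exact (by fun_prop : Continuous fun s => R s * -Real.sin (s - m)).intervalIntegrable _ _

/-- The analytic form of the four vertex theorem: a `2π`-periodic function that is orthogonal to
`cos` and `sin` has at least four critical points in a period. -/
theorem four_le_encard_deriv_eq_zero {R : ℝ → ℝ} (hR : ContDiff ℝ 1 R)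
    (hper : Periodic R (2 * Real.pi))
    (hcos : ∫ s in (0 : ℝ)..(2 * Real.pi), R s * Real.cos s = 0)
    (hsin : ∫ s in (0 : ℝ)..(2 * Real.pi), R s * Real.sin s = 0) :
    4 ≤ {s | s ∈ Ico 0 (2 * Real.pi) ∧ deriv R s = 0}.encard := by
  have hpi := Real.two_pi_pos
  have hRd := hR.differentiable one_ne_zero
  have hRc := hR.continuous
  have hdc : Continuous (deriv R) := hR.continuous_deriv le_rfl
  have hdper : ∀ s, deriv R s = 0 → ∀ k : ℤ, deriv R (s - k * (2 * Real.pi)) = 0 := by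
    intro s hs k
    have : (fun x => R (x - k * (2 * Real.pi))) = R := funext fun x => hper.sub_int_mul_eq k
    rw [← deriv_comp_sub_const, this, hs]
  have hred : ∀ s, ∃ u ∈ Icc (0 : ℝ) (2 * Real.pi), R s = R u := fun s => by
    obtain ⟨u, hu, h⟩ := hper.exists_mem_Ico₀ hpi s
    exact ⟨u, Ico_subset_Icc_self hu, h⟩
  obtain ⟨a, -, ha⟩ := isCompact_Icc.exists_isMaxOn (nonempty_Icc.2 hpi.le) hRc.continuousOn
  obtain ⟨b₀, -, hb₀⟩ := isCompact_Icc.exists_isMinOn (nonempty_Icc.2 hpi.le) hRc.continuousOn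
  have hmax : ∀ s, R s ≤ R a := fun s => by
    obtain ⟨u, hu, h⟩ := hred s
    rw [h]; exact ha hu
  obtain ⟨b, hb, hbb⟩ := hper.exists_mem_Ico hpi b₀ a
  have hmin : ∀ s, R b ≤ R s := fun s => by
    obtain ⟨u, hu, h⟩ := hred s
    rw [h, ← hbb]; exact hb₀ hu
  rcases eq_or_ne (R a) (R b) with heq | hne
  · have hconst : R = fun _ => R a := funext fun s => le_antisymm (hmax s) (heq ▸ hmin s)
    have h0 : ∀ s, deriv R s = 0 := fun s => by rw [hconst]; simp
    have : {s | s ∈ Ico 0 (2 * Real.pi) ∧ deriv R s = 0} = Ico 0 (2 * Real.pi) := by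
      ext s; simp [h0 s]
    rw [this, (Ico_infinite hpi).encard_eq]
    exact le_top
  have hlt : R b < R a := lt_of_le_of_ne (hmin a) hne.symm
  have hab : a < b := lt_of_le_of_ne hb.1 fun h => hne (by rw [h])
  have hba := hb.2
  have hda : deriv R a = 0 := IsLocalMax.deriv_eq_zero (Filter.Eventually.of_forall hmax)
  have hdb : deriv R b = 0 := IsLocalMin.deriv_eq_zero (Filter.Eventually.of_forall hmin)
  -- Otherwise `R' ≤ 0` between the maximum `a` and the minimum `b`, and `R' ≥ 0` from `b` to `a +
  -- 2π`. The function `L` has the same signs and lies in the span of `1` and a translate of `cos`,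
  -- so `R' L` is nonnegative with zero integral, although it is positive somewhere.
  have hdisj : (∃ x ∈ Ioo a b, 0 < deriv R x) ∨
      ∃ x ∈ Ioo b (a + 2 * Real.pi), deriv R x < 0 := by
    by_contra! hcon
    obtain ⟨hcon1, hcon2⟩ := hcon
    let L : ℝ → ℝ := fun s => Real.sin ((s - a) / 2) * Real.sin ((s - b) / 2)
    have hLeq : ∀ s, L s = (Real.cos ((b - a) / 2) - Real.cos (s - (a + b) / 2)) / 2 := fun s => by
      have h1 := Real.cos_sub ((s - a) / 2) ((s - b) / 2)
      have h2 := Real.cos_add ((s - a) / 2) ((s - b) / 2)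
      rw [show (s - a) / 2 - (s - b) / 2 = (b - a) / 2 by ring] at h1
      rw [show (s - a) / 2 + (s - b) / 2 = s - (a + b) / 2 by ring] at h2
      simp only [L]
      linarith
    have hint : ∫ s in a..(a + 2 * Real.pi), deriv R s * L s = 0 := by
      have h1 := integral_deriv_mul_cos_sub hR hper hcos hsin a ((a + b) / 2)
      have h2 : ∫ s in a..(a + 2 * Real.pi), deriv R s = 0 := by
        rw [intervalIntegral.integral_deriv_eq_sub (fun s _ => hRd s)
          (hdc.intervalIntegrable _ _), hper, sub_self]
      have h3 : ∀ s, deriv R s * L s = Real.cos ((b - a) / 2) / 2 * deriv R s -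
          1 / 2 * (deriv R s * Real.cos (s - (a + b) / 2)) := fun s => by rw [hLeq]; ring
      simp_rw [h3]
      rw [intervalIntegral.integral_sub, intervalIntegral.integral_const_mul,
        intervalIntegral.integral_const_mul, h1, h2]
      · simp
      · exact (hdc.const_mul _).intervalIntegrable _ _
      · exact (by fun_prop : Continuous _).intervalIntegrable _ _
    have hLneg : ∀ s ∈ Ioo a b, L s < 0 := fun s hs =>
      mul_neg_of_pos_of_neg
        (Real.sin_pos_of_pos_of_lt_pi (by linarith [hs.1]) (by linarith [hs.2]))
        (Real.sin_neg_of_neg_of_neg_pi_lt (by linarith [hs.2]) (by linarith [hs.1]))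
    have hLpos : ∀ s ∈ Ioo b (a + 2 * Real.pi), 0 < L s := fun s hs =>
      mul_pos (Real.sin_pos_of_pos_of_lt_pi (by linarith [hs.1]) (by linarith [hs.2]))
        (Real.sin_pos_of_pos_of_lt_pi (by linarith [hs.1]) (by linarith [hs.2]))
    have hnonneg : ∀ s ∈ Ioc a (a + 2 * Real.pi), 0 ≤ deriv R s * L s := by
      intro s hs
      rcases lt_trichotomy s b with hsb | rfl | hsb
      · exact mul_nonneg_of_nonpos_of_nonpos (hcon1 s ⟨hs.1, hsb⟩) (hLneg s ⟨hs.1, hsb⟩).le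
      · simp [hdb]
      · rcases hs.2.lt_or_eq with hs2 | rfl
        · exact mul_nonneg (hcon2 s ⟨hsb, hs2⟩) (hLpos s ⟨hsb, hs2⟩).le
        · simp [L]
    obtain ⟨c, hc, hdc'⟩ := exists_deriv_eq_slope R hab hRc.continuousOn hRd.differentiableOn
    have hcneg : deriv R c < 0 := by
      rw [hdc']; exact div_neg_of_neg_of_pos (by linarith) (by linarith)
    have hpos := intervalIntegral.integral_pos (a := a) (b := a + 2 * Real.pi)
      (f := fun s => deriv R s * L s) (by linarith)
      (hdc.mul (by fun_prop)).continuousOn hnonneg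
      ⟨c, ⟨hc.1.le, by linarith [hc.2]⟩, mul_pos_of_neg_of_neg hcneg (hLneg c hc)⟩
    linarith
  -- A derivative of the wrong sign at `x` gives one more critical point on either side of `x`,
  -- besides `a` and `b`.
  rcases hdisj with ⟨x, hx, hpos⟩ | ⟨x, hx, hneg⟩
  · obtain ⟨z₁, hz₁, h₁⟩ := exists_deriv_eq_zero_of_le hR hx.1 (hmax x)
      (right_mem_Icc.2 hx.1.le) hpos
    obtain ⟨z₂, hz₂, h₂⟩ := exists_deriv_eq_zero_of_le hR hx.2 (hmin x)
      (left_mem_Icc.2 hx.2.le) hpos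
    have := hz₁.1; have := hz₁.2; have := hz₂.1; have := hz₂.2
    refine encard_le_of_strictMono (n := 4) (z := ![a, z₁, z₂, b]) (a := a) hpi hdper ?_ ?_ ?_
    · refine Fin.strictMono_iff_lt_succ.2 fun i => ?_
      fin_cases i <;> simp <;> linarith
    · intro i
      fin_cases i <;> simp <;> (try constructor) <;> linarith [Real.pi_pos]
    · intro i
      fin_cases i <;> simp [*]
  · have hmax' : ∀ s, R s ≤ R (a + 2 * Real.pi) := fun s => by rw [hper]; exact hmax s
    obtain ⟨z₁, hz₁, h₁⟩ := exists_deriv_eq_zero_of_ge hR hx.1 (hmin x)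
      (right_mem_Icc.2 hx.1.le) hneg
    obtain ⟨z₂, hz₂, h₂⟩ := exists_deriv_eq_zero_of_ge hR hx.2 (hmax' x)
      (left_mem_Icc.2 hx.2.le) hneg
    have := hz₁.1; have := hz₁.2; have := hz₂.1; have := hz₂.2
    refine encard_le_of_strictMono (n := 4) (z := ![a, b, z₁, z₂]) (a := a) hpi hdper ?_ ?_ ?_
    · refine Fin.strictMono_iff_lt_succ.2 fun i => ?_
      fin_cases i <;> simp <;> linarith
    · intro i
      fin_cases i <;> simp <;> (try constructor) <;> linarith [Real.pi_pos]
    · intro i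
      fin_cases i <;> simp [*]

end FourVertex

/-! ### Closing up after one turn. -/

section Turning

open Complex in
/-- A locally convex plane curve, parametrized by the angle of its normal and star-shaped with
respect to the origin, that has no self-intersections closes up after one turn. -/
theorem exists_eq_add_two_pi {c : ℝ → ℂ} {R : ℝ → ℝ}
    (hc : ∀ s, HasDerivAt c (-R s * (I * exp (s * I))) s) (hR : ∀ s, 0 < R s)
    (hre : ∀ s : ℝ, (c s * exp (-(s * I))).re < 0) (hmax : ∃ s₀, ∀ s, ‖c s‖ ≤ ‖c s₀‖)
    (hinj : ∀ s s' : ℝ, c s = c s' → exp (s * I) = exp (s' * I)) :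
    ∃ s, c (s + 2 * Real.pi) = c s := by
  -- `z` is the curve in the frame that rotates with its normal. It stays in the left half plane, so
  -- the principal argument of `-z` is smooth.
  let z : ℝ → ℂ := fun s => c s * exp (-(s * I))
  have hz : ∀ s, HasDerivAt z (-I * (R s + z s)) s := by
    intro s
    have h1 : HasDerivAt (fun s : ℝ => -((s : ℂ) * I)) (-I) s := by
      have := ((hasDerivAt_id s).ofReal_comp.mul_const I).neg
      simp only [Complex.ofReal_one, one_mul] at this
      exact this
    have h2 := (hc s).mul h1.cexp
    refine h2.congr_deriv ?_
    have : exp (s * I) * exp (-(s * I)) = 1 := by rw [← exp_add]; simp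
    change _ = -I * (R s + c s * exp (-(s * I)))
    linear_combination (-R s * I) * this
  have hz0 : ∀ s, z s ≠ 0 := fun s h0 => by
    have : (z s).re < 0 := hre s
    rw [h0] at this; simp at this
  -- A continuous polar angle of `-c`. Its derivative `-R Re z / |z|²` is positive, so the polar
  -- angle can replace the parameter; `σ` below is the inverse change.
  let θ : ℝ → ℝ := fun s => s + arg (-z s)
  have hθ : ∀ s, HasDerivAt θ (-R s * (z s).re / normSq (z s)) s := by
    intro s
    have hsl : -z s ∈ slitPlane := Or.inl (by rw [neg_re]; exact neg_pos.2 (hre s))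
    have h1 := ((hz s).neg.clog_real hsl)
    have h2 := imCLM.hasFDerivAt.comp_hasDerivAt s h1
    have h3 := (hasDerivAt_id s).add h2
    have h4 : HasDerivAt θ (1 + (-(-I * (R s + z s)) / -z s).im) s := by
      refine h3.congr_of_eventuallyEq (Filter.Eventually.of_forall fun t => ?_)
      simp [θ, log_im]
    refine h4.congr_deriv ?_
    have h5 : -(-I * (R s + z s)) / -z s = -(R s * I * (z s)⁻¹) - I := by
      have := hz0 s
      field_simp
      ring
    rw [h5]
    simp [inv_re]
    ring
  have hmono : StrictMono θ := by
    refine strictMono_of_deriv_pos fun s => ?_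
    rw [(hθ s).deriv]
    exact div_pos (mul_pos_of_neg_of_neg (neg_lt_zero.2 (hR s)) (hre s))
      (normSq_pos.2 (hz0 s))
  have hcont : Continuous θ := continuous_iff_continuousAt.2 fun s => (hθ s).continuousAt
  have hbd : ∀ s, s - Real.pi ≤ θ s ∧ θ s ≤ s + Real.pi := fun s =>
    ⟨by have := neg_pi_lt_arg (-z s); simp only [θ]; linarith,
      by have := arg_le_pi (-z s); simp only [θ]; linarith⟩
  have hsurj : Surjective θ := hcont.surjective
    (Filter.tendsto_atTop_mono (fun s => (hbd s).1) (Filter.tendsto_atTop_add_const_right _ _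
      Filter.tendsto_id))
    (Filter.tendsto_atBot_mono (fun s => (hbd s).2) (Filter.tendsto_atBot_add_const_right _ _
      Filter.tendsto_id))
  let σ : ℝ → ℝ := (hmono.orderIsoOfSurjective θ hsurj).symm
  have hσc : Continuous σ := (hmono.orderIsoOfSurjective θ hsurj).symm.continuous
  have hθσ : ∀ x, θ (σ x) = x := fun x => (hmono.orderIsoOfSurjective θ hsurj).apply_symm_apply x
  have hσθ : ∀ s, σ (θ s) = s := fun s => (hmono.orderIsoOfSurjective θ hsurj).symm_apply_apply s
  have hpolar : ∀ s, c s = -(‖c s‖ * exp (θ s * I)) := by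
    intro s
    have h1 := norm_mul_exp_arg_mul_I (-z s)
    have h2 : ‖-z s‖ = ‖c s‖ := by
      have : ‖exp (-(s * I))‖ = 1 := by
        rw [show -((s : ℂ) * I) = ((-s : ℝ) : ℂ) * I by push_cast; ring, norm_exp_ofReal_mul_I]
      simp [z, this]
    have h3 : c s = z s * exp (s * I) := by
      simp only [z]; rw [mul_assoc, ← exp_add]; simp
    rw [h2] at h1
    have h4 : exp (θ s * I) = exp (arg (-z s) * I) * exp (s * I) := by
      rw [← exp_add]; simp only [θ]; push_cast; ring_nf
    rw [h4, ← mul_assoc, h1, neg_mul, neg_neg, ← h3]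
  obtain ⟨s₀, hs₀⟩ := hmax
  have hcc : Continuous c := continuous_iff_continuousAt.2 fun s => (hc s).continuousAt
  -- The gain in distance from the origin over one full turn of polar angle: nonpositive when the
  -- turn starts at the farthest point, nonnegative when it ends there. A zero of `D` is a
  -- self-intersection.
  let D : ℝ → ℝ := fun x => ‖c (σ (x + 2 * Real.pi))‖ - ‖c (σ x)‖
  have hD : Continuous D := by fun_prop
  have hD0 : D (θ s₀) ≤ 0 := by
    simp only [D, hσθ]; linarith [hs₀ (σ (θ s₀ + 2 * Real.pi))]
  have hD1 : 0 ≤ D (θ s₀ - 2 * Real.pi) := by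
    simp only [D, sub_add_cancel, hσθ]; linarith [hs₀ (σ (θ s₀ - 2 * Real.pi))]
  obtain ⟨x, -, hx⟩ := intermediate_value_uIcc (a := θ s₀) (b := θ s₀ - 2 * Real.pi)
    hD.continuousOn (show (0 : ℝ) ∈ uIcc _ _ from mem_uIcc.2 (Or.inl ⟨hD0, hD1⟩))
  have heq : c (σ (x + 2 * Real.pi)) = c (σ x) := by
    have hn : ‖c (σ (x + 2 * Real.pi))‖ = ‖c (σ x)‖ := sub_eq_zero.1 hx
    rw [hpolar (σ (x + 2 * Real.pi)), hpolar (σ x), hθσ, hθσ, hn]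
    have : exp ((x + 2 * Real.pi : ℝ) * I) = exp (x * I) := by
      rw [← exp_periodic (x * I)]; push_cast; ring_nf
    rw [this]
  have hexp := hinj _ _ heq
  have hzz : z (σ (x + 2 * Real.pi)) = z (σ x) := by
    simp only [z, exp_neg, heq, hexp]
  -- The values of `z` agree, so the arguments cancel and the parameters differ by exactly `2π`, not
  -- merely by some multiple.
  have hstep : σ (x + 2 * Real.pi) = σ x + 2 * Real.pi := by
    have h1 := hθσ (x + 2 * Real.pi)
    have h2 := hθσ x
    simp only [θ] at h1 h2
    rw [hzz] at h1
    linarith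
  exact ⟨σ x, by rw [← hstep, heq]⟩

end Turning

/-! ### Local homeomorphisms to the cylinder with complete rays. -/

section CylinderCovering

variable {N : Type*} [TopologicalSpace N] [T2Space N] {G : N → ℝ × Circle} {γ : N → ℝ → N}

theorem IsLocalHomeomorph.eq_of_lifts {A X : Type*} [TopologicalSpace A] [PreconnectedSpace A]
    [TopologicalSpace X] {G : N → X} (hG : IsLocalHomeomorph G) {g₁ g₂ : A → N}
    (h₁ : Continuous g₁) (h₂ : Continuous g₂) (he : ∀ x, G (g₁ x) = G (g₂ x)) (a : A)
    (ha : g₁ a = g₂ a) : g₁ = g₂ :=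
  (T2Space.isSeparatedMap G).eq_of_comp_eq hG.isLocallyInjective h₁ h₂ (funext he) a ha

/-- Homotopy lifting: `(u, t, p) ↦ γ p (u t)` is continuous in `u` and continuous at the start `u =
0`, and lifts a continuous map, so it is jointly continuous; take `u = 1`. -/
theorem continuous_flow (hG : IsLocalHomeomorph G) (hγc : ∀ p, Continuous (γ p))
    (hγ0 : ∀ p, γ p 0 = p) (hγG : ∀ p t, G (γ p t) = ((G p).1 + t, (G p).2)) :
    Continuous fun x : ℝ × N => γ x.2 x.1 := by
  have hGc := hG.continuous
  let f : C(unitInterval × (ℝ × N), ℝ × Circle) :=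
    ⟨fun x => ((G x.2.2).1 + x.1 * x.2.1, (G x.2.2).2), by fun_prop⟩
  have h := hG.continuous_lift (T2Space.isSeparatedMap G) f
    (g := fun x => γ x.2.2 (x.1 * x.2.1)) (funext fun x => hγG _ _)
    (by simpa [hγ0] using continuous_snd) (fun a => (hγc a.2).comp (by fun_prop))
  have h2 := h.comp (g := fun x : unitInterval × (ℝ × N) => γ x.2.2 (x.1 * x.2.1))
    (Continuous.prodMk_right (1 : unitInterval))
  simpa [comp_def] using h2

theorem flow_add (hG : IsLocalHomeomorph G) (hγc : ∀ p, Continuous (γ p))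
    (hγ0 : ∀ p, γ p 0 = p) (hγG : ∀ p t, G (γ p t) = ((G p).1 + t, (G p).2)) (p : N) (s t : ℝ) :
    γ (γ p s) t = γ p (s + t) := by
  refine congrFun (hG.eq_of_lifts (hγc (γ p s)) (g₂ := fun t => γ p (s + t))
    ((hγc p).comp (by fun_prop)) (fun t => ?_) 0 (by simp [hγ0])) t
  simp [hγG, add_assoc]

/-- Points over a compact `K` flow to `S` in a time confined to the compact set of differences of
time coordinates. So `G` is proper, and a proper local homeomorphism of this kind is a covering. -/
theorem isCoveringMap_of_flow (hG : IsLocalHomeomorph G) (hγc : ∀ p, Continuous (γ p))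
    (hγ0 : ∀ p, γ p 0 = p) (hγG : ∀ p t, G (γ p t) = ((G p).1 + t, (G p).2)) {S : Set N}
    (hS : IsCompact S) (hγS : ∀ p, ∃ t, γ p t ∈ S) : IsCoveringMap G := by
  have hflow := continuous_flow hG hγc hγ0 hγG
  have hGc := hG.continuous
  have hproper : IsProperMap G := by
    refine isProperMap_iff_isCompact_preimage.2 ⟨hGc, fun K hK => ?_⟩
    have hD : IsCompact ((fun x : ℝ × ℝ => x.1 - x.2) ''
        ((Prod.fst '' K) ×ˢ ((fun p => (G p).1) '' S))) :=
      ((hK.image continuous_fst).prod (hS.image (by fun_prop))).image (by fun_prop)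
    refine ((hD.prod hS).image hflow).of_isClosed_subset (hK.isClosed.preimage hGc) fun p hp => ?_
    obtain ⟨t, ht⟩ := hγS p
    refine ⟨(-t, γ p t), ⟨⟨((G p).1, (G (γ p t)).1), ⟨⟨G p, hp, rfl⟩, ⟨γ p t, ht, rfl⟩⟩, ?_⟩, ht⟩, ?_⟩
    · simp [hγG]
    · simp [flow_add hG hγc hγ0 hγG, hγ0]
  rw [isCoveringMap_iff_isCoveringMapOn_univ]
  refine hproper.isClosedMap.isCoveringMapOn_of_isLocalHomeomorphOn (fun x _ => ?_) ?_
  · refine (hproper.isCompact_preimage isCompact_singleton).finite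
      (.of_openPartialHomeomorph G subset_rfl fun e _ => ?_)
    obtain ⟨φ, hφ, h⟩ := hG e
    exact ⟨φ, hφ, h.symm⟩
  · simpa [← isLocalHomeomorph_iff_isLocalHomeomorphOn_univ] using hG

/-- `Φ` lifts the universal cover of the cylinder through `G`. All its properties are uniqueness of
lifts; in particular `Φ` and its translate by `2π` lift the same map, so one coincidence makes them
equal. -/
theorem exists_cylinder_cover [PathConnectedSpace N] (hG : IsLocalHomeomorph G)
    (hγc : ∀ p, Continuous (γ p)) (hγ0 : ∀ p, γ p 0 = p)
    (hγG : ∀ p t, G (γ p t) = ((G p).1 + t, (G p).2)) {S : Set N}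
    (hS : IsCompact S) (hγS : ∀ p, ∃ t, γ p t ∈ S) :
    ∃ Φ : ℝ × ℝ → N, Continuous Φ ∧ Surjective Φ ∧ (∀ x, G (Φ x) = (x.1, Circle.exp x.2)) ∧
      (∀ t s, Φ (t, s) = γ (Φ (0, s)) t) ∧
      ∀ t₀ s₀, Φ (t₀, s₀ + 2 * Real.pi) = Φ (t₀, s₀) →
        ∀ t s, Φ (t, s + 2 * Real.pi) = Φ (t, s) := by
  have hcov := isCoveringMap_of_flow hG hγc hγ0 hγG hS hγS
  obtain ⟨p⟩ := (inferInstance : Nonempty N)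
  obtain ⟨Φ, ⟨-, hΦ⟩, -⟩ := hcov.existsUnique_continuousMap_lifts
    (⟨fun x => (x.1, Circle.exp x.2), by fun_prop⟩ : C(ℝ × ℝ, ℝ × Circle))
    (0, Complex.arg (G p).2) (γ p (-(G p).1)) (by simp [hγG, Circle.exp_arg])
  have hΦG : ∀ x, G (Φ x) = (x.1, Circle.exp x.2) := fun x => congrFun hΦ x
  refine ⟨Φ, Φ.continuous, fun q => ?_, hΦG, fun t s => ?_, fun t₀ s₀ h t s => ?_⟩
  · let κ := PathConnectedSpace.somePath (Φ (0, 0)) q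
    have hGc := hG.continuous
    -- For surjectivity, the angle along a path from `Φ (0, 0)` to `q` is lifted to `ℝ`; `Φ` of the
    -- lifted path then retraces the path.
    let ζ : C(unitInterval, Circle) := ⟨fun u => (G (κ u)).2, by fun_prop⟩
    have hζ : ζ 0 = Circle.exp 0 := by simp [ζ, hΦG]
    let d := Circle.isCoveringMap_exp.liftPath ζ 0 hζ
    have hd : ∀ u, Circle.exp (d u) = (G (κ u)).2 :=
      fun u => congrFun (Circle.isCoveringMap_exp.liftPath_lifts ζ 0 hζ) u
    have hd0 : d 0 = 0 := Circle.isCoveringMap_exp.liftPath_zero ζ 0 hζ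
    have := hG.eq_of_lifts (g₁ := κ) (g₂ := fun u => Φ ((G (κ u)).1, d u)) κ.continuous
      (by fun_prop) (fun u => by rw [hΦG]; exact Prod.ext rfl (hd u).symm) 0
      (by simp [hd0, hΦG])
    exact ⟨_, by simpa using (congrFun this 1).symm⟩
  · refine congrFun (hG.eq_of_lifts (g₁ := fun t => Φ (t, s)) (by fun_prop) (hγc _)
      (fun t => ?_) 0 (hγ0 _).symm) t
    rw [hΦG, hγG, hΦG]
    simp
  · have := hG.eq_of_lifts (g₁ := fun x : ℝ × ℝ => Φ (x.1, x.2 + 2 * Real.pi)) (by fun_prop)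
      Φ.continuous (fun x => by rw [hΦG, hΦG]; simp [Circle.exp_add]) (t₀, s₀) h
    exact congrFun this (t, s)

end CylinderCovering

/-! ### Elementary operations on local diffeomorphisms. -/

section LocalDiffeo

variable {E E' : Type*} [NormedAddCommGroup E] [NormedSpace ℝ E]
  [NormedAddCommGroup E'] [NormedSpace ℝ E'] {M : Type*} [TopologicalSpace M] [ChartedSpace E' M]
  {r : WithTop ℕ∞}

theorem IsLocalDiffeomorphAt.congr_of_eventuallyEq {f g : E → M} {x : E}
    (hf : IsLocalDiffeomorphAt 𝓘(ℝ, E) 𝓘(ℝ, E') r f x) (h : g =ᶠ[𝓝 x] f) :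
    IsLocalDiffeomorphAt 𝓘(ℝ, E) 𝓘(ℝ, E') r g x := by
  obtain ⟨Φ, hx, heq⟩ := hf
  obtain ⟨U, hU, hUo, hxU⟩ := eventually_nhds_iff.1 h
  let Ψ := Φ.toOpenPartialHomeomorph.restrOpen U hUo
  refine ⟨{ toPartialEquiv := Ψ.toPartialEquiv
            open_source := Ψ.open_source
            open_target := Ψ.open_target
            contMDiffOn_toFun := Φ.contMDiffOn_toFun.mono fun y hy => hy.1
            contMDiffOn_invFun := Φ.contMDiffOn_invFun.mono fun y hy => hy.1 }, ⟨hx, hxU⟩, ?_⟩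
  intro y hy
  exact (hU y hy.2).trans (heq hy.1)

theorem isLocalDiffeomorphAt_add_right (a x : E) :
    IsLocalDiffeomorphAt 𝓘(ℝ, E) 𝓘(ℝ, E) r (fun y => y + a) x :=
  ⟨{ toPartialEquiv := (Homeomorph.addRight a).toPartialEquiv
     open_source := isOpen_univ
     open_target := isOpen_univ
     contMDiffOn_toFun := (contDiff_id.add contDiff_const).contMDiff.contMDiffOn
     contMDiffOn_invFun := (contDiff_id.add contDiff_const).contMDiff.contMDiffOn },
    mem_univ x, fun _ _ => rfl⟩

end LocalDiffeo

/-! ### Angle coordinates and the parametrization of a component. -/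

namespace IsRulingData

variable {M : Type*} [TopologicalSpace M] [ChartedSpace Plane M]
  {r : WithTop ℕ∞} {τ : M → ℝ} {y ν : M → ℂ} {X : M → Plane} (h : IsRulingData r τ y ν X)
include h

/-- Where `dν ≠ 0`, the time and the angle of `ν` are local coordinates. -/
theorem exists_angle_chart [IsManifold (𝓡 2) r M] (hr : 1 ≤ r) {p : M}
    (hp : diffAt Plane ν p ≠ 0) :
    ∃ e : PartialDiffeomorph (𝓡 2) 𝓘(ℝ, ℝ × ℝ) M (ℝ × ℝ) r, p ∈ e.source ∧ (e p).2 = 0 ∧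
      ∀ q ∈ e.source, (e q).1 = τ q ∧ ν q = ν p * Circle.exp (e q).2 := by
  have hr0 : r ≠ 0 := by rintro rfl; simp at hr
  -- Multiplying by the conjugate of `ν p` rotates `ν p` to `1`, away from the cut of the logarithm.
  let cp : ℂ := (starRingEnd ℂ) (ν p)
  have hνp : ν p * cp = 1 := by
    rw [Complex.mul_conj, Complex.normSq_eq_norm_sq, h.norm_dir]; simp
  let V : Set M := (fun q => ν q * cp) ⁻¹' Complex.slitPlane
  have hV : IsOpen V := Complex.isOpen_slitPlane.preimage
    (h.smooth_dir.continuous.mul continuous_const)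
  have hpV : p ∈ V := by
    change ν p * cp ∈ Complex.slitPlane
    rw [hνp]; exact Complex.one_mem_slitPlane
  let θ : M → ℝ := fun q => (Complex.log (ν q * cp)).im
  have hθ : ContMDiffOn (𝓡 2) 𝓘(ℝ, ℝ) r θ V := by
    intro q hq
    have h1 : ContDiffAt ℝ r (fun z : ℂ => (Complex.log (z * cp)).im) (ν q) := by
      have h2 : ContDiffAt ℝ r Complex.log (ν q * cp) :=
        (Complex.contDiffAt_log (n := r) hq).restrict_scalars ℝ
      exact Complex.imCLM.contDiff.contDiffAt.comp _
        (h2.comp (ν q) (contDiffAt_id.mul contDiffAt_const))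
    exact (h1.comp_contMDiffAt (h.smooth_dir q)).contMDiffWithinAt
  let g : M → ℝ × ℝ := fun q => (τ q, θ q)
  have hg : ContMDiffOn (𝓡 2) 𝓘(ℝ, ℝ × ℝ) r g V := h.smooth_time.contMDiffOn.prodMk_space hθ
  have hτd := h.smooth_time.mdifferentiable hr0 p
  have hθd : MDifferentiableAt (𝓡 2) 𝓘(ℝ, ℝ) θ p :=
    (hθ.contMDiffAt (hV.mem_nhds hpV)).mdifferentiableAt hr0
  have hdθ : ∀ v, diffAt Plane θ p v = (diffAt Plane ν p v * cp).im := by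
    intro v
    have h1 := (hasDerivAt_comp_chartLine (h.smooth_dir.mdifferentiable hr0 p) v).mul_const cp
    have h2 := h1.clog_real (by rw [comp_apply, chartLine_zero]; exact hpV)
    have h3 := Complex.imCLM.hasFDerivAt.comp_hasDerivAt (0 : ℝ) h2
    have h4 := (hasDerivAt_comp_chartLine hθd v).unique h3
    simpa [chartLine_zero, hνp] using h4
  have hinj : Injective (diffAt Plane g p) := by
    rw [injective_iff_map_eq_zero]
    intro v hv
    rw [diffAt_prodMk hτd hθd, Prod.mk_eq_zero, hdθ] at hv
    refine h.eq_zero_of_diffAt (h.dir_field p) hp hv.1 ?_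
    obtain ⟨b, hb⟩ := h.dir_tangent p v
    have : diffAt Plane ν p v * cp = b * Complex.I := by
      rw [hb]; linear_combination (b * Complex.I) * hνp
    rw [this] at hv
    have hb0 : b = 0 := by simpa using hv.2
    rw [hb, hb0]; simp
  obtain ⟨e, hpe, heg⟩ := isLocalDiffeomorphAt_of_injective_mfderiv (E := Plane) hr (by simp)
    hV hg hpV hinj
  refine ⟨e, hpe, ?_, fun q hq => ⟨by rw [← heg hq], ?_⟩⟩
  · rw [← heg hpe]
    simp [g, θ, hνp]
  · rw [← heg hq]
    have hn : ‖ν q * cp‖ = 1 := by simp [cp, h.norm_dir]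
    have h1 := Complex.norm_mul_exp_arg_mul_I (ν q * cp)
    rw [hn, ← Complex.log_im, Complex.ofReal_one, one_mul] at h1
    rw [Circle.coe_exp]
    simp only [g, θ]
    rw [h1]
    linear_combination (-ν q) * hνp

/-- The time and the direction of a ray, as a map to a cylinder. -/
def cylinderMap (h : IsRulingData r τ y ν X) (p : M) : ℝ × Circle :=
  (τ p, ⟨ν p, by simp [Submonoid.unitSphere, h.norm_dir p]⟩)

theorem isLocalHomeomorphOn_cylinderMap [IsManifold (𝓡 2) r M] (hr : 1 ≤ r) :
    IsLocalHomeomorphOn h.cylinderMap {p | diffAt Plane ν p ≠ 0} := by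
  refine IsLocalHomeomorphOn.mk _ _ fun p hp => ?_
  obtain ⟨e, hpe, -, he⟩ := h.exists_angle_chart hr hp
  obtain ⟨φ, hφ, hφe⟩ := isLocalHomeomorph_circleExp (e p).2
  let ψ : OpenPartialHomeomorph (ℝ × ℝ) (ℝ × Circle) := (OpenPartialHomeomorph.refl ℝ).prod
    (φ.trans (Homeomorph.mulLeft (h.cylinderMap p).2).toOpenPartialHomeomorph)
  refine ⟨e.toOpenPartialHomeomorph.trans ψ, ⟨hpe, ⟨mem_univ _, hφ, mem_univ _⟩⟩, ?_⟩
  intro q hq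
  obtain ⟨h1, h2⟩ := he q hq.1
  change h.cylinderMap q = ((e q).1, (h.cylinderMap p).2 * φ (e q).2)
  rw [← hφe]
  exact Prod.ext h1.symm (Subtype.ext h2)

/-- The rays that meet the focal set, in the component of a focal point, are parametrized by the
cylinder: the parametrization of the component by the universal cover of the cylinder. -/
theorem exists_universal_cover [T2Space M] [IsManifold (𝓡 2) r M] (hr : 1 ≤ r)
    (hS : IsCompact {p | ∀ v, diffAt Plane y p v + τ p * diffAt Plane ν p v = 0}) {p₀ : M}
    (hp₀ : ∀ v, diffAt Plane y p₀ v + τ p₀ * diffAt Plane ν p₀ v = 0) :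
    ∃ (Φ : ℝ × ℝ → M) (Y : ℝ → ℂ) (T : ℝ → ℝ),
      IsLocalDiffeomorph 𝓘(ℝ, ℝ × ℝ) (𝓡 2) r Φ ∧ range Φ = connectedComponent p₀ ∧
      (∀ t s, τ (Φ (t, s)) = t) ∧ (∀ t s : ℝ, ν (Φ (t, s)) = Circle.exp s) ∧
      (∀ t s, y (Φ (t, s)) = Y s) ∧ ContDiff ℝ r Y ∧
      (∀ s, HasDerivAt Y (-T s * (Complex.I * Circle.exp s)) s) ∧
      (∀ t s, (∀ v, diffAt Plane y (Φ (t, s)) v + t * diffAt Plane ν (Φ (t, s)) v = 0) ↔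
        t = T s) ∧
      ∀ t₀ s₀, Φ (t₀, s₀ + 2 * Real.pi) = Φ (t₀, s₀) →
        ∀ t s, Φ (t, s + 2 * Real.pi) = Φ (t, s) := by
  have hr0 : r ≠ 0 := by rintro rfl; simp at hr
  have : LocallyPathConnectedSpace M := ChartedSpace.locallyPathConnectedSpace Plane M
  obtain ⟨C, hC⟩ : ∃ C, ∀ p, (∀ v, diffAt Plane y p v + τ p * diffAt Plane ν p v = 0) →
      |τ p| ≤ C := by
    obtain ⟨C, hC⟩ := hS.exists_bound_of_continuousOn h.smooth_time.continuous.continuousOn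
    exact ⟨C, fun p hp => hC p hp⟩
  have hclopen := h.isClopen_dir_ne_zero hr hC
  set S : Set M := {p | ∀ v, diffAt Plane y p v + τ p * diffAt Plane ν p v = 0} with hSdef
  let N : Set M := connectedComponent p₀
  have hNB : N ⊆ {p | diffAt Plane ν p ≠ 0} :=
    hclopen.connectedComponent_subset (h.dir_ne_zero_of_focal hp₀)
  have hNo : IsOpen N := isOpen_connectedComponent
  have hpc : PathConnectedSpace N := by
    rw [← isPathConnected_iff_pathConnectedSpace,
      ← hNo.isConnected_iff_isPathConnected]
    exact isConnected_connectedComponent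
  choose γ hγ hγ0 hray using h.ray
  have hγc : ∀ p, Continuous (γ p) := fun p => continuous_iff_continuousAt.2 fun t => (hγ p t).1
  have hγN : ∀ p ∈ N, ∀ t, γ p t ∈ N := by
    intro p hp t
    have h1 : IsPreconnected (range (γ p)) := isPreconnected_range (hγc p)
    have h2 : range (γ p) ⊆ connectedComponent p :=
      h1.subset_connectedComponent ⟨0, hγ0 p⟩
    have h3 : connectedComponent p = N := (connectedComponent_eq hp).symm
    exact h3 ▸ h2 (mem_range_self t)
  let G : N → ℝ × Circle := fun p => h.cylinderMap p
  have hG : IsLocalHomeomorph G := by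
    rw [isLocalHomeomorph_iff_isLocalHomeomorphOn_univ]
    exact (h.isLocalHomeomorphOn_cylinderMap hr).comp
      (hNo.isOpenEmbedding_subtypeVal.isLocalHomeomorph.isLocalHomeomorphOn)
      fun p _ => hNB p.2
  let γN : N → ℝ → N := fun p t => ⟨γ p t, hγN p p.2 t⟩
  obtain ⟨Φ, hΦc, hΦs, hΦG, hΦγ, hΦper⟩ := exists_cylinder_cover (γ := γN) hG
    (fun p => (hγc p).subtype_mk _) (fun p => Subtype.ext (hγ0 p))
    (fun p t => Prod.ext (hray p t).1 (Subtype.ext (hray p t).2.2))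
    (S := Subtype.val ⁻¹' S)
    (Topology.IsClosedEmbedding.isCompact_preimage
      (isClosed_connectedComponent.isClosedEmbedding_subtypeVal) hS)
    (fun p => by
      obtain ⟨T, hT⟩ := h.exists_focal_time (hNB p.2)
      exact ⟨T - τ p, h.exists_focal_point hr (hγ p) (hγ0 p) (fun t => (hray p t).1) hT⟩)
  have hτΦ : ∀ x, τ (Φ x) = x.1 := fun x => congrArg Prod.fst (hΦG x)
  have hνΦ : ∀ x, ν (Φ x) = Circle.exp x.2 := fun x =>
    congrArg (fun z : ℝ × Circle => (z.2 : ℂ)) (hΦG x)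
  have hloc : IsLocalDiffeomorph 𝓘(ℝ, ℝ × ℝ) (𝓡 2) r (fun x => (Φ x : M)) := by
    intro x
    obtain ⟨e, hpe, hep, he⟩ := h.exists_angle_chart hr (hNB (Φ x).2)
    have hcont : ContinuousAt (fun x' => (Φ x' : M)) x :=
      (continuous_subtype_val.comp hΦc).continuousAt
    have hec : ContinuousAt (fun x' => (e (Φ x')).2) x := by
      have h1 : ContinuousAt e (Φ x : M) :=
        e.toOpenPartialHomeomorph.continuousAt hpe
      exact continuous_snd.continuousAt.comp (h1.comp (f := fun x' => (Φ x' : M)) hcont)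
    have hev1 : ∀ᶠ x' in 𝓝 x, (Φ x' : M) ∈ e.source :=
      hcont.eventually_mem (e.open_source.mem_nhds hpe)
    have hev2 : ∀ᶠ x' in 𝓝 x, |(e (Φ x')).2| < Real.pi :=
      hec.abs.eventually_lt continuousAt_const (by rw [hep]; simpa using Real.pi_pos)
    have hev3 : ∀ᶠ x' : ℝ × ℝ in 𝓝 x, |x'.2 - x.2| < Real.pi :=
      ContinuousAt.eventually_lt (by fun_prop) continuousAt_const (by simpa using Real.pi_pos)
    -- Near `x` the map `Φ` is the inverse of the angle chart after a translation. The angles agree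
    -- modulo `2π`, and both increments are below `π` in absolute value, so the integer ambiguity is
    -- zero.
    have hee : ∀ᶠ x' in 𝓝 x, (Φ x' : M) = (e.symm ∘ fun z => z + (0, -x.2)) x' := by
      filter_upwards [hev1, hev2, hev3] with x' h1 h2 h3
      obtain ⟨h4, h5⟩ := he _ h1
      have h6 : Circle.exp x'.2 = Circle.exp (x.2 + (e (Φ x')).2) := by
        rw [hνΦ, hνΦ] at h5
        rw [Circle.exp_add]
        exact Subtype.ext h5
      obtain ⟨m, hm⟩ := Circle.exp_eq_exp.1 h6
      have h7 : m = 0 := by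
        rw [abs_lt] at h2 h3
        have h8 : (m : ℝ) * (2 * Real.pi) < 1 * (2 * Real.pi) := by linarith
        have h9 : (-1 : ℝ) * (2 * Real.pi) < m * (2 * Real.pi) := by linarith
        have h10 := lt_of_mul_lt_mul_right h8 Real.two_pi_pos.le
        have h11 := lt_of_mul_lt_mul_right h9 Real.two_pi_pos.le
        have h12 : m < 1 := by exact_mod_cast h10
        have h13 : -1 < m := by exact_mod_cast h11
        omega
      have h14 : e (Φ x') = x' + (0, -x.2) := by
        refine Prod.ext ?_ ?_
        · rw [h4, hτΦ]; simp
        · rw [h7] at hm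
          simp at hm ⊢
          linarith
      have h15 : e.symm (e (Φ x')) = (Φ x' : M) := e.left_inv h1
      rw [h14] at h15
      exact h15.symm
    refine IsLocalDiffeomorphAt.congr_of_eventuallyEq (f := e.symm ∘ fun z => z + (0, -x.2)) ?_ hee
    refine (isLocalDiffeomorphAt_add_right _ _).comp (𝓡 2) M (e.symm.isLocalDiffeomorphAt _ _ _ ?_)
    have h1 : x + (0, -x.2) = e (Φ x) := by
      refine Prod.ext ?_ ?_
      · rw [(he _ hpe).1, hτΦ]; simp
      · rw [hep]; simp
    rw [h1]
    exact e.map_source hpe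
  have hyΦ : ∀ t s, y (Φ (t, s)) = y (Φ (0, s)) := fun t s => by
    rw [hΦγ]; exact (hray _ t).2.1
  have hΦsm : ContMDiff 𝓘(ℝ, ℝ × ℝ) (𝓡 2) r (fun x => (Φ x : M)) := hloc.contMDiff
  choose T hT using fun s => h.exists_focal_time (hNB (Φ (0, s)).2)
  have hTt : ∀ t s v, diffAt Plane y (Φ (t, s)) v + T s * diffAt Plane ν (Φ (t, s)) v = 0 := by
    intro t s
    rw [hΦγ]
    refine h.focal_of_ray hr (hγ (Φ (0, s))) (s := 0) ?_ t
    rw [hγ0]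
    exact hT s
  have hY : ContDiff ℝ r (fun s => y (Φ (0, s))) := by
    rw [← contMDiff_iff_contDiff]
    have h1 : ContMDiff 𝓘(ℝ, ℝ) 𝓘(ℝ, ℝ × ℝ) r (fun s : ℝ => ((0 : ℝ), s)) :=
      (contDiff_const.prodMk contDiff_id).contMDiff
    exact h.smooth_pos.comp (hΦsm.comp h1)
  refine ⟨fun x => Φ x, fun s => y (Φ (0, s)), T, hloc, ?_, fun t s => hτΦ _, fun t s => hνΦ _,
    hyΦ, hY, fun s => ?_, fun t s => ⟨fun hts => ?_, fun hts => ?_⟩, fun t₀ s₀ hts t s => ?_⟩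
  · change range (Subtype.val ∘ Φ) = N
    rw [range_comp, hΦs.range_eq, image_univ, Subtype.range_coe]
  · have hmd : MDifferentiableAt 𝓘(ℝ, ℝ × ℝ) 𝓘(ℝ, Plane) (fun x => (Φ x : M)) (0, s) :=
      hΦsm.mdifferentiable hr0 _
    have hline : HasDerivAt (fun s : ℝ => ((0 : ℝ), s)) (0, 1) s :=
      (hasDerivAt_const s 0).prodMk (hasDerivAt_id s)
    have h1 := (hasFDerivAt_comp_diffTo hmd (h.smooth_pos.mdifferentiable hr0 _)).comp_hasDerivAt
      (f := fun s : ℝ => ((0 : ℝ), s)) s hline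
    have h2 := (hasFDerivAt_comp_diffTo hmd (h.smooth_dir.mdifferentiable hr0 _)).comp_hasDerivAt
      (f := fun s : ℝ => ((0 : ℝ), s)) s hline
    have h3 : HasDerivAt (fun s : ℝ => (Circle.exp s : ℂ)) (Complex.I * Circle.exp s) s := by
      have := ((hasDerivAt_id s).ofReal_comp.mul_const Complex.I).cexp
      simp only [Circle.coe_exp]
      refine this.congr_deriv ?_
      simp [mul_comm]
    have h4 := h2.unique (h3.congr_of_eventuallyEq (Filter.Eventually.of_forall fun s => hνΦ _))
    -- The focal relation on the image of the `s`-direction, where `dν` is `i e^{is}`, is the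
    -- formula for the derivative of `Y`.
    have h5 := hT s (diffTo Plane (fun x => (Φ x : M)) (0, s) (0, 1))
    refine h1.congr_deriv ?_
    rw [ContinuousLinearMap.comp_apply] at h4 ⊢
    rw [h4] at h5
    linear_combination h5
  · by_contra hne
    apply hNB (Φ (t, s)).2
    ext v
    have h1 := hts v
    have h2 := hTt t s v
    have h3 : ((t : ℂ) - T s) * diffAt Plane ν (Φ (t, s)) v = 0 := by linear_combination h1 - h2
    have h4 : (t : ℂ) - T s ≠ 0 := by
      rw [sub_ne_zero]; exact_mod_cast hne
    simpa [h4] using h3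
  · rw [hts]; exact hTt _ s
  · exact congrArg Subtype.val (hΦper t₀ s₀ (Subtype.ext hts) t s)

end IsRulingData

theorem eq_of_mem_Ico_of_eq_add_int_mul {l s s' : ℝ} {k : ℤ} (hs : s ∈ Ico 0 l)
    (hs' : s' ∈ Ico 0 l) (h : s' = s + k * l) : s = s' := by
  have hl : 0 < l := hs.1.trans_lt hs.2
  have h1 : (k : ℝ) < 1 := lt_of_mul_lt_mul_right (by linarith [hs.1, hs'.2]) hl.le
  have h2 : (-1 : ℝ) < k := lt_of_mul_lt_mul_right (by linarith [hs'.1, hs.2]) hl.le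
  have h3 : k < 1 := by exact_mod_cast h1
  have h4 : -1 < k := by exact_mod_cast h2
  have h5 : k = 0 := by omega
  simp [h, h5]

/-! ### Convex curves parametrized by the angle of the normal. -/

section PlaneCurve

/-- The complex plane as the Euclidean plane. -/
noncomputable def toPlane : ℂ ≃ₗᵢ[ℝ] Plane := Complex.orthonormalBasisOneI.repr

theorem toPlane_apply_zero (z : ℂ) : toPlane z 0 = z.re := by
  simp [toPlane]

theorem toPlane_apply_one (z : ℂ) : toPlane z 1 = z.im := by
  simp [toPlane]

theorem toPlane_hasDerivAt {C : ℝ → ℂ} {C' : ℂ} {s : ℝ} (h : HasDerivAt C C' s) :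
    HasDerivAt (fun s => toPlane (C s)) (toPlane C') s :=
  (toPlane.toContinuousLinearEquiv : ℂ →L[ℝ] Plane).hasFDerivAt.comp_hasDerivAt s h

theorem toPlane_inner (z w : ℂ) : inner ℝ (toPlane z) (toPlane w) = (z * (starRingEnd ℂ) w).re := by
  rw [LinearIsometryEquiv.inner_map_map, Complex.inner]
  simp [mul_comm]

theorem hasDerivAt_circleExp (s : ℝ) :
    HasDerivAt (fun s : ℝ => (Circle.exp s : ℂ)) (Complex.I * Circle.exp s) s := by
  have := ((hasDerivAt_id s).ofReal_comp.mul_const Complex.I).cexp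
  simp only [Circle.coe_exp]
  refine this.congr_deriv ?_
  simp [mul_comm]

theorem contDiff_circleExp {r : WithTop ℕ∞} : ContDiff ℝ r fun s : ℝ => (Circle.exp s : ℂ) := by
  simp only [Circle.coe_exp]
  have h1 : ContDiff ℝ r Complex.exp := (Complex.contDiff_exp (𝕜 := ℂ)).restrict_scalars ℝ
  exact h1.comp (Complex.ofRealCLM.contDiff.mul contDiff_const)

theorem circleExp_mul_conj (s : ℝ) :
    (Circle.exp s : ℂ) * (starRingEnd ℂ) (Circle.exp s : ℂ) = 1 := by
  rw [Complex.mul_conj, Circle.normSq_coe, Complex.ofReal_one]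

variable {r : WithTop ℕ∞} {C : ℝ → ℂ} {R : ℝ → ℝ}
  (hder : ∀ s, HasDerivAt C (-R s * (Complex.I * Circle.exp s)) s)
include hder

/-- The radius is read off from `C'`, which loses one derivative; `r + 1 = r` absorbs the loss. -/
theorem contDiff_radius_of_hasDerivAt (hr : r + 1 = r) (hC : ContDiff ℝ r C) :
    ContDiff ℝ r R := by
  have h1 : ContDiff ℝ r (deriv C) := by
    rw [← hr] at hC
    exact (contDiff_succ_iff_deriv.1 hC).2.2
  have h2 : R = fun s => (deriv C s * (Complex.I * (starRingEnd ℂ) (Circle.exp s : ℂ))).re := by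
    funext s
    rw [(hder s).deriv]
    have : -(R s : ℂ) * (Complex.I * Circle.exp s) * (Complex.I * (starRingEnd ℂ) (Circle.exp s : ℂ))
        = R s := by
      linear_combination (-(R s : ℂ) * Complex.I ^ 2) * circleExp_mul_conj s -
        (R s : ℂ) * Complex.I_sq
    rw [this, Complex.ofReal_re]
  rw [h2]
  exact Complex.reCLM.contDiff.comp (h1.mul (contDiff_const.mul
    (Complex.conjCLE.contDiff.comp contDiff_circleExp)))

/-- The normal turns at unit rate and the speed is `R`, so `R` is the radius of curvature. -/
theorem planeCurvature_toPlane (hR : Differentiable ℝ R) (hpos : ∀ s, 0 < R s) :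
    planeCurvature (fun s => toPlane (C s)) (fun s => toPlane (Circle.exp s : ℂ)) =
      fun s => (R s)⁻¹ := by
  funext s
  have h1 : deriv (fun s => toPlane (C s)) =
      fun s => toPlane (-R s * (Complex.I * Circle.exp s)) :=
    funext fun s => (toPlane_hasDerivAt (hder s)).deriv
  have h2 : HasDerivAt (fun s => -(R s : ℂ) * (Complex.I * Circle.exp s)) _ s :=
    (hR s).hasDerivAt.ofReal_comp.fun_neg.fun_mul ((hasDerivAt_circleExp s).const_mul Complex.I)
  have h3 : ‖-(R s : ℂ) * (Complex.I * Circle.exp s)‖ = R s := by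
    simp [abs_of_pos (hpos s)]
  have h4 : ((-((deriv R s : ℝ) : ℂ) * (Complex.I * Circle.exp s) +
      -(R s : ℂ) * (Complex.I * (Complex.I * Circle.exp s))) *
        (starRingEnd ℂ) (Circle.exp s : ℂ)) = R s - deriv R s * Complex.I := by
    linear_combination (-((deriv R s : ℝ) : ℂ) * Complex.I - (R s : ℂ) * Complex.I ^ 2) *
      circleExp_mul_conj s - (R s : ℂ) * Complex.I_sq
  rw [planeCurvature, h1, (toPlane_hasDerivAt h2).deriv, toPlane_inner, h4,
    LinearIsometryEquiv.norm_map, h3]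
  have := (hpos s).ne'
  simp
  field_simp

theorem isConvexClosedCurve_toPlane (hC : ContDiff ℝ r C)
    (hpos : ∀ s, 0 < R s) (hR : Differentiable ℝ R) (hper : Periodic C (2 * Real.pi))
    (hinj : ∀ s s', C s = C s' → Circle.exp s = Circle.exp s') :
    IsConvexClosedCurve r (2 * Real.pi) (fun s => toPlane (C s))
      (fun s => toPlane (Circle.exp s : ℂ)) := by
  have hlin : ContDiff ℝ r toPlane := toPlane.contDiff
  refine ⟨Real.two_pi_pos, hlin.comp hC, hlin.comp contDiff_circleExp, fun s => by simp [hper s],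
    fun s hs s' hs' h => ?_, fun s => ?_, fun s => by simp, fun s => ?_, fun s => ?_⟩
  · obtain ⟨m, hm⟩ := Circle.exp_eq_exp.1 (hinj s s' (toPlane.injective h))
    exact (eq_of_mem_Ico_of_eq_add_int_mul hs' hs hm).symm
  · rw [(toPlane_hasDerivAt (hder s)).deriv]
    simp [(hpos s).ne']
  · rw [(toPlane_hasDerivAt (hder s)).deriv, toPlane_inner]
    have : -(R s : ℂ) * (Complex.I * Circle.exp s) * (starRingEnd ℂ) (Circle.exp s : ℂ) =
        -(R s : ℂ) * Complex.I := by
      linear_combination (-(R s : ℂ) * Complex.I) * circleExp_mul_conj s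
    rw [this]; simp
  · rw [planeCurvature_toPlane hder hR hpos]
    exact inv_pos.2 (hpos s)

theorem isVertex_toPlane_iff (hR : Differentiable ℝ R) (hpos : ∀ s, 0 < R s) (s : ℝ) :
    IsVertex (fun s => toPlane (C s)) (fun s => toPlane (Circle.exp s : ℂ)) s ↔
      deriv R s = 0 := by
  rw [IsVertex, planeCurvature_toPlane hder hR hpos,
    ((hR s).hasDerivAt.fun_inv (hpos s).ne').deriv]
  simp [(hpos s).ne']

/-- The integral of `C'` over a period vanishes because `C` closes up; its real and imaginary parts
are the orthogonality of `R` to `sin` and `cos`. -/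
theorem four_le_encard_critical_radius (hR : ContDiff ℝ 1 R) (hper : Periodic C (2 * Real.pi)) :
    4 ≤ {s | s ∈ Ico 0 (2 * Real.pi) ∧ deriv R s = 0}.encard := by
  have hRper : Periodic R (2 * Real.pi) := by
    intro s
    have h1 := (hder (s + 2 * Real.pi)).comp_add_const s (2 * Real.pi)
    have h2 := h1.unique ((hder s).congr_of_eventuallyEq (Filter.Eventually.of_forall hper))
    rw [Circle.exp_add, Circle.exp_two_pi, mul_one] at h2
    have h3 : (Complex.I * Circle.exp s : ℂ) ≠ 0 := by simp
    exact_mod_cast neg_injective (mul_right_cancel₀ h3 h2)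
  have hcont : Continuous fun s => -(R s : ℂ) * (Complex.I * Circle.exp s) := by
    have := hR.continuous
    fun_prop
  have hint : ∫ s in (0 : ℝ)..(2 * Real.pi), -(R s : ℂ) * (Complex.I * Circle.exp s) = 0 := by
    rw [intervalIntegral.integral_eq_sub_of_hasDerivAt (fun s _ => hder s)
      (hcont.intervalIntegrable _ _)]
    have := hper 0
    rw [zero_add] at this
    rw [this, sub_self]
  have hL (L : ℂ →L[ℝ] ℝ) :
      ∫ s in (0 : ℝ)..(2 * Real.pi), L (-(R s : ℂ) * (Complex.I * Circle.exp s)) = 0 := by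
    rw [L.intervalIntegral_comp_comm (hcont.intervalIntegrable _ _), hint, map_zero]
  have hre (s : ℝ) : Complex.reCLM (-(R s : ℂ) * (Complex.I * Circle.exp s)) =
      R s * Real.sin s := by
    simp [Circle.coe_exp, Complex.exp_ofReal_mul_I_re, Complex.exp_ofReal_mul_I_im]
  have him (s : ℝ) : -Complex.imCLM (-(R s : ℂ) * (Complex.I * Circle.exp s)) =
      R s * Real.cos s := by
    simp [Circle.coe_exp, Complex.exp_ofReal_mul_I_re, Complex.exp_ofReal_mul_I_im]
  refine four_le_encard_deriv_eq_zero hR hRper ?_ ?_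
  · simp only [← him, intervalIntegral.integral_neg, hL, neg_zero]
  · simp only [← hre, hL]

end PlaneCurve

/-! ### The singular curve at a cuspidal edge. -/

section CuspidalEdge

variable {M : Type*} [TopologicalSpace M] [ChartedSpace Plane M]

theorem hasDerivAt_comp_curve {E' : Type*} [NormedAddCommGroup E'] [NormedSpace ℝ E']
    {f : M → E'} {δ : ℝ → M} {s : ℝ} (hδ : MDifferentiableAt 𝓘(ℝ, ℝ) (𝓡 2) δ s)
    (hf : MDifferentiableAt (𝓡 2) 𝓘(ℝ, E') f (δ s)) :
    HasDerivAt (f ∘ δ) (diffAt Plane f (δ s) (diffTo Plane δ s 1)) s :=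
  (hasFDerivAt_comp_diffTo hδ hf).hasDerivAt

theorem diffAt_injective_of_openPartialHomeomorph [IsManifold (𝓡 2) ∞ M]
    {φ : OpenPartialHomeomorph M Plane}
    (h1 : ContMDiffOn (𝓡 2) (𝓡 2) ∞ φ φ.source)
    (h2 : ContMDiffOn (𝓡 2) (𝓡 2) ∞ φ.symm φ.target) {p : M} (hp : p ∈ φ.source) :
    Injective (diffAt Plane φ p) := by
  have hφ : IsLocalDiffeomorphAt (𝓡 2) (𝓡 2) ∞ φ p :=
    ⟨{ toPartialEquiv := φ.toPartialEquiv
       open_source := φ.open_source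
       open_target := φ.open_target
       contMDiffOn_toFun := h1
       contMDiffOn_invFun := h2 }, hp, fun _ _ => rfl⟩
  have h3 := (hφ.mfderivToContinuousLinearEquiv (by simp)).injective
  have h4 : mfderiv (𝓡 2) 𝓘(ℝ, Plane) φ p = diffAt Plane φ p :=
    mfderiv_eq_diffAt (hφ.contMDiffAt.mdifferentiableAt (by simp))
  intro v w hvw
  apply h3
  have h5 : ∀ v : Plane, hφ.mfderivToContinuousLinearEquiv (by simp) v = diffAt Plane φ p v := by
    intro v
    rw [← h4]
    rfl
  exact (h5 v).trans (hvw.trans (h5 w).symm)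

/-- A curve of singular points through a cuspidal edge is immersed by `F` if it is immersed. -/
theorem IsCuspidalEdge.diffTo_eq_zero [IsManifold (𝓡 2) ∞ M] {r : WithTop ℕ∞} (hr : r ≠ 0)
    {F : M → Minkowski3} (hF : ContMDiff (𝓡 2) 𝓘(ℝ, Minkowski3) r F) {δ : ℝ → M} {s : ℝ}
    (hp : IsCuspidalEdge F (δ s)) (hδ : MDifferentiableAt 𝓘(ℝ, ℝ) (𝓡 2) δ s)
    (hsing : ∀ σ, δ σ ∈ singularSet F) (h0 : HasDerivAt (F ∘ δ) 0 s) :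
    diffTo Plane δ s 1 = 0 := by
  obtain ⟨φ, ψ, hφ, hφs, hψ, -, hps, -, -, -, hform⟩ := hp
  have hφd : ∀ q ∈ φ.source, MDifferentiableAt (𝓡 2) 𝓘(ℝ, Plane) φ q := fun q hq =>
    (hφ.contMDiffAt (φ.open_source.mem_nhds hq)).mdifferentiableAt (by simp)
  have hψd : ∀ q ∈ φ.source, DifferentiableAt ℝ ψ (F q) := fun q hq =>
    (hψ.contDiffAt (ψ.open_source.mem_nhds (hform q hq).1)).differentiableAt (by simp)
  have coord {n : ℕ} {g : ℝ → EuclideanSpace ℝ (Fin n)} {v : EuclideanSpace ℝ (Fin n)} {t : ℝ}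
      (hg : HasDerivAt g v t) (i : Fin n) : HasDerivAt (fun t => g t i) (v i) t :=
    ((EuclideanSpace.proj i : EuclideanSpace ℝ (Fin n) →L[ℝ] ℝ)).hasFDerivAt.comp_hasDerivAt t hg
  -- In the normal form `(u, v², v³)` the singular set lies in `v = 0`: for `v ≠ 0` the first two
  -- components already determine the velocity.
  have hzero : ∀ q ∈ φ.source, q ∈ singularSet F → φ q 1 = 0 := by
    intro q hq hqs
    by_contra hne
    obtain ⟨v, hv, hFv⟩ := (mem_singularSet_iff hF hr q).1 hqs
    have h1 : HasDerivAt (F ∘ chartLine q v) 0 0 :=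
      hFv ▸ hasDerivAt_comp_chartLine (hF.mdifferentiable hr q) v
    have h2 : HasDerivAt (ψ ∘ (F ∘ chartLine q v)) 0 0 := by
      have h3 : HasFDerivAt ψ (fderiv ℝ ψ (F q)) ((F ∘ chartLine q v) 0) := by
        rw [comp_apply, chartLine_zero]; exact (hψd q hq).hasFDerivAt
      simpa using h3.comp_hasDerivAt (0 : ℝ) h1
    have h4 : HasDerivAt (φ ∘ chartLine q v) (diffAt Plane φ q v) 0 :=
      hasDerivAt_comp_chartLine (hφd q hq) v
    have hev : ∀ᶠ t in 𝓝 (0 : ℝ), chartLine q v t ∈ φ.source :=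
      (continuousAt_chartLine q v).eventually_mem
        (φ.open_source.mem_nhds (by rwa [chartLine_zero]))
    have h5 : diffAt Plane φ q v 0 = 0 := by
      refine (coord h4 0).unique (((coord h2 0).congr_of_eventuallyEq ?_))
      filter_upwards [hev] with t ht
      simp [(hform _ ht).2]
    have h6 : 2 * φ q 1 * diffAt Plane φ q v 1 = 0 := by
      have h7 := (coord h4 1).fun_pow 2
      refine Eq.trans ?_ (h7.unique ((coord h2 1).congr_of_eventuallyEq ?_))
      · simp [chartLine_zero]
      · filter_upwards [hev] with t ht
        simp [(hform _ ht).2]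
    have h8 : diffAt Plane φ q v 1 = 0 := by simpa [hne] using h6
    apply hv
    apply diffAt_injective_of_openPartialHomeomorph hφ hφs hq
    rw [map_zero]
    ext i
    fin_cases i
    · exact h5
    · exact h8
  have hev : ∀ᶠ σ in 𝓝 s, δ σ ∈ φ.source :=
    hδ.continuousAt.eventually_mem (φ.open_source.mem_nhds hps)
  have h1 : HasDerivAt (φ ∘ δ) (diffAt Plane φ (δ s) (diffTo Plane δ s 1)) s :=
    hasDerivAt_comp_curve hδ (hφd _ hps)
  have h2 : HasDerivAt (ψ ∘ (F ∘ δ)) 0 s := by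
    simpa using (hψd _ hps).hasFDerivAt.comp_hasDerivAt s h0
  -- Along the singular curve `v` vanishes identically, and the velocity of `u` is a component of
  -- the velocity of `ψ ∘ F ∘ δ`, which is zero.
  apply diffAt_injective_of_openPartialHomeomorph hφ hφs hps
  rw [map_zero]
  ext i
  fin_cases i
  · refine (coord h1 0).unique ((coord h2 0).congr_of_eventuallyEq ?_)
    filter_upwards [hev] with t ht
    simp [(hform _ ht).2]
  · refine (coord h1 1).unique ((hasDerivAt_const s (0 : ℝ)).congr_of_eventuallyEq ?_)
    filter_upwards [hev] with t ht
    exact hzero _ ht (hsing t)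

end CuspidalEdge

/-! ### The generating curve and the main theorem. -/

section CompleteNullFronts

variable {M : Type*} [TopologicalSpace M] [T2Space M] [ChartedSpace Plane M]

/-- A component of a complete null wave front without self-intersections at infinity is generated by
a closed convex curve, the vertices of which give singular points other than cuspidal edges. -/
theorem IsCompleteNullWaveFront.exists_isGeneratedBy {r : WithTop ℕ∞} (hr0 : r ≠ 0)
    (hr1 : 1 ≤ r) (hrs : r + 1 = r) [IsManifold (𝓡 2) ∞ M] [IsManifold (𝓡 2) r M]
    {F : M → Minkowski3} (hF : IsCompleteNullWaveFront r F)
    {K : Set Minkowski3} (hK : IsCompact K) (hself : ∀ p q : M, p ≠ q → F p = F q → F p ∈ K)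
    {p₀ : M} (hp₀ : p₀ ∈ singularSet F) :
    ∃ (t₀ ℓ : ℝ) (c ν : ℝ → Plane) (Φ : ℝ × ℝ → M),
      IsConvexClosedCurve r ℓ c ν ∧ IsGeneratedBy r F (connectedComponent p₀) t₀ ℓ c ν Φ ∧
      4 ≤ {s : ℝ | s ∈ Ico 0 ℓ ∧ IsVertex c ν s}.encard ∧
      ∀ s, IsVertex c ν s →
        Φ (1 / planeCurvature c ν s, s) ∈ singularSet F ∧
          ¬ IsCuspidalEdge F (Φ (1 / planeCurvature c ν s, s)) := by
  obtain ⟨y, ν, X, hd, hform, hsing⟩ := exists_isRulingData hr0 hF.nullWaveFront hF.lComplete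
  have hFs : ContMDiff (𝓡 2) 𝓘(ℝ, Minkowski3) r F := by
    obtain ⟨α, hα, -⟩ := hF.nullWaveFront
    exact hα.contMDiff
  have hS : {p | ∀ v, diffAt Plane y p v + F p 0 * diffAt Plane ν p v = 0} = singularSet F :=
    ext fun p => (hsing p).symm
  have hScpt := hF.singular_compact
  obtain ⟨Φ, Y, T, hloc, hrange, hτ, hν, hy, hYs, hYd, hT, hper⟩ :=
    hd.exists_universal_cover hr1 (by rw [hS]; exact hScpt) ((hsing p₀).1 hp₀)
  have hΦs : ∀ t s, Φ (t, s) ∈ singularSet F ↔ t = T s := fun t s => by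
    rw [hsing, hτ, hT]
  have hFΦ : ∀ t s, F (Φ (t, s)) = !₂[t, (Y s + t * Circle.exp s).re,
      (Y s + t * Circle.exp s).im] := fun t s => by
    rw [hform, hτ, hy, hν]
  -- bounds on the focal set and on the self-intersections
  obtain ⟨A, hA⟩ := hScpt.exists_bound_of_continuousOn hd.smooth_time.continuous.continuousOn
  obtain ⟨B, hB⟩ := hScpt.exists_bound_of_continuousOn hd.smooth_pos.continuous.continuousOn
  obtain ⟨D, hD⟩ := hK.isBounded.exists_norm_le
  have hTA : ∀ s, |T s| ≤ A := fun s => by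
    have := hA _ ((hΦs (T s) s).2 rfl)
    rwa [hτ, Real.norm_eq_abs] at this
  have hYB : ∀ s, ‖Y s‖ ≤ B := fun s => by
    have := hB _ ((hΦs (T s) s).2 rfl)
    rwa [hy] at this
  have hA0 : 0 ≤ A := (abs_nonneg _).trans (hTA 0)
  have hB0 : 0 ≤ B := (norm_nonneg _).trans (hYB 0)
  have hD0 := abs_nonneg D
  -- In this constant `A` makes the radius `T - t₀` positive, `B` keeps the origin on the inner side
  -- of every tangent line, and `|D| + 1` puts the slice outside `K`.
  obtain ⟨t₀, ht₀⟩ : ∃ t₀, t₀ = -(A + B + |D| + 1) := ⟨_, rfl⟩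
  let C : ℝ → ℂ := fun s => Y s + t₀ * Circle.exp s
  let R : ℝ → ℝ := fun s => T s - t₀
  have hR : ∀ s, 0 < R s := fun s => by
    have := (abs_le.1 (hTA s)).1
    simp only [R]; linarith
  have hCd : ∀ s, HasDerivAt C (-R s * (Complex.I * Circle.exp s)) s := fun s => by
    refine ((hYd s).add ((hasDerivAt_circleExp s).const_mul (t₀ : ℂ))).congr_deriv ?_
    simp only [R]; push_cast; ring
  have hCs : ContDiff ℝ r C := hYs.add (contDiff_const.mul contDiff_circleExp)
  have hinjΦ : ∀ s s', C s = C s' → Φ (t₀, s) = Φ (t₀, s') := by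
    intro s s' hss
    by_contra hne
    have h1 := hself _ _ hne (by
      rw [hFΦ, hFΦ]
      change !₂[t₀, (C s).re, (C s).im] = !₂[t₀, (C s').re, (C s').im]
      rw [hss])
    have h2 := (PiLp.norm_apply_le (F (Φ (t₀, s))) 0).trans (hD _ h1)
    rw [hτ, Real.norm_eq_abs] at h2
    have h3 := neg_abs_le t₀
    have h4 := le_abs_self D
    linarith
  have hinj : ∀ s s', C s = C s' → Circle.exp s = Circle.exp s' := fun s s' hss => by
    have := congrArg ν (hinjΦ s s' hss)
    rw [hν, hν] at this
    exact Subtype.ext this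
  -- Each `C s` is the value of `y + t₀ ν` at the singular point of its ray, so the maximum is taken
  -- over a compact set even before the curve is known to close up.
  have hmax : ∃ s₀, ∀ s, ‖C s‖ ≤ ‖C s₀‖ := by
    have hcpt : IsCompact (singularSet F ∩ range Φ) := by
      rw [hrange]; exact hScpt.inter_right isClosed_connectedComponent
    obtain ⟨p, ⟨hpS, ⟨t, s₀⟩, rfl⟩, hmax⟩ := hcpt.exists_isMaxOn
      ⟨_, (hΦs (T 0) 0).2 rfl, mem_range_self _⟩
      (f := fun p => ‖y p + t₀ * ν p‖)
      ((hd.smooth_pos.continuous.add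
        (continuous_const.mul hd.smooth_dir.continuous)).norm.continuousOn)
    refine ⟨s₀, fun s => ?_⟩
    have := hmax ⟨(hΦs (T s) s).2 rfl, mem_range_self _⟩
    simpa [hy, hν, C] using this
  have hre : ∀ s : ℝ, (C s * Complex.exp (-(s * Complex.I))).re < 0 := fun s => by
    have h1 : C s * Complex.exp (-(s * Complex.I)) = Y s * Complex.exp (-(s * Complex.I)) + t₀ := by
      simp only [C, Circle.coe_exp]
      rw [add_mul, mul_assoc, ← Complex.exp_add, add_neg_cancel, Complex.exp_zero, mul_one]
    have h2 : ‖Y s * Complex.exp (-(s * Complex.I))‖ ≤ B := by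
      rw [norm_mul, ← neg_mul, ← Complex.ofReal_neg, Complex.norm_exp_ofReal_mul_I, mul_one]
      exact hYB s
    rw [h1, Complex.add_re, Complex.ofReal_re]
    linarith [(Complex.re_le_norm _).trans h2]
  obtain ⟨s₁, hs₁⟩ := exists_eq_add_two_pi (c := C) (R := R)
    (fun s => by simpa only [Circle.coe_exp] using hCd s) hR hre hmax
    (fun s s' hss => by simpa only [Circle.coe_exp] using congrArg Subtype.val (hinj s s' hss))
  have hΦper := hper t₀ s₁ (hinjΦ _ _ hs₁)
  have hCper : Periodic C (2 * Real.pi) := fun s => by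
    have h1 := hy 0 (s + 2 * Real.pi)
    rw [hΦper, hy] at h1
    simp only [C, Circle.exp_add, Circle.exp_two_pi, mul_one, h1]
  have hRs : ContDiff ℝ r R := contDiff_radius_of_hasDerivAt hCd hrs hCs
  have hRd : Differentiable ℝ R := hRs.differentiable hr0
  have hκ := planeCurvature_toPlane hCd hRd hR
  have hΦm : MDifferentiable 𝓘(ℝ, ℝ × ℝ) (𝓡 2) Φ := hloc.contMDiff.mdifferentiable hr0
  refine ⟨t₀, 2 * Real.pi, fun s => toPlane (C s), fun s => toPlane (Circle.exp s : ℂ),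
    fun x => Φ (x + (t₀, 0)), isConvexClosedCurve_toPlane hCd hCs hR hRd hCper hinj,
    ⟨fun x => ?_, ?_, fun x x' => ?_, fun x => ?_⟩, ?_, fun s hs => ?_⟩
  · exact (isLocalDiffeomorphAt_add_right _ _).comp (𝓡 2) M (hloc _)
  · rw [← hrange]
    exact (Equiv.addRight ((t₀, 0) : ℝ × ℝ)).surjective.range_comp Φ
  · constructor
    · intro hxx
      have h1 := (hτ (x + (t₀, 0)).1 (x + (t₀, 0)).2).symm.trans
        ((congrArg (fun p => F p 0) hxx).trans (hτ (x' + (t₀, 0)).1 (x' + (t₀, 0)).2))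
      have h2 := (hν (x + (t₀, 0)).1 (x + (t₀, 0)).2).symm.trans
        ((congrArg ν hxx).trans (hν (x' + (t₀, 0)).1 (x' + (t₀, 0)).2))
      obtain ⟨m, hm⟩ := Circle.exp_eq_exp.1 (Subtype.ext h2.symm)
      simp only [Prod.fst_add, Prod.snd_add, add_zero] at h1 hm
      exact ⟨by linarith, m, hm⟩
    · rintro ⟨h1, k, hk⟩
      have h2 : Periodic (fun s => Φ (x.1 + t₀, s)) (2 * Real.pi) := hΦper _
      have h3 := h2.int_mul k x.2
      have h4 : x' + (t₀, 0) = (x.1 + t₀, x.2 + k * (2 * Real.pi)) :=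
        Prod.ext (by simp [h1]) (by simp [hk])
      have h5 : x + (t₀, 0) = (x.1 + t₀, x.2) := Prod.ext (by simp) (by simp)
      rw [h4, h5]
      exact h3.symm
  · have h1 : x + (t₀, 0) = (x.1 + t₀, x.2) := Prod.ext (by simp) (by simp)
    rw [h1, hFΦ, nullNormalForm]
    simp only [toPlane_apply_zero, toPlane_apply_one]
    have h2 : Y x.2 + ((x.1 + t₀ : ℝ) : ℂ) * Circle.exp x.2 = C x.2 + x.1 * Circle.exp x.2 := by
      simp only [C]; push_cast; ring
    rw [h2, Complex.add_re, Complex.add_im, Complex.re_ofReal_mul, Complex.im_ofReal_mul,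
      add_comm x.1]
  · simp only [isVertex_toPlane_iff hCd hRd hR]
    exact four_le_encard_critical_radius hCd (hRs.of_le hr1) hCper
  -- The radius `1 / κ = T - t₀` is the time from the slice to the focal point.
  · have h1 : (1 / planeCurvature (fun s => toPlane (C s))
        (fun s => toPlane (Circle.exp s : ℂ)) s, s) + (t₀, 0) = (T s, s) := by
      rw [hκ]
      exact Prod.ext (by simp [R]) (by simp)
    beta_reduce
    rw [h1]
    refine ⟨(hΦs _ _).2 rfl, fun hcusp => ?_⟩
    have hTd : HasDerivAt T 0 s := by
      have h2 := (hRd s).hasDerivAt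
      rw [(isVertex_toPlane_iff hCd hRd hR s).1 hs] at h2
      simpa [R] using h2.add_const t₀
    have hline : HasDerivAt (fun σ => (T σ, σ)) ((0 : ℝ), (1 : ℝ)) s :=
      hTd.prodMk (hasDerivAt_id s)
    have hlinem : HasMFDerivAt 𝓘(ℝ, ℝ) 𝓘(ℝ, ℝ × ℝ) (fun σ => (T σ, σ)) s
        (ContinuousLinearMap.toSpanSingleton ℝ ((0 : ℝ), (1 : ℝ))) :=
      hline.hasFDerivAt.hasMFDerivAt
    -- The curve of singular points. Its image has velocity `T' (1, ν)`, which vanishes at a vertex,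
    -- while `δ` itself has velocity `dΦ (0, 1) ≠ 0`.
    let δ : ℝ → M := fun σ => Φ (T σ, σ)
    have hδ : HasMFDerivAt 𝓘(ℝ, ℝ) (𝓡 2) δ s ((diffTo Plane Φ (T s, s)).comp
        (ContinuousLinearMap.toSpanSingleton ℝ ((0 : ℝ), (1 : ℝ)))) :=
      HasMFDerivAt.comp (g := Φ) s (hΦm (T s, s)).hasMFDerivAt hlinem
    have hδ1 : diffTo Plane δ s 1 = diffTo Plane Φ (T s, s) (0, 1) := by
      have h2 : diffTo Plane δ s = (diffTo Plane Φ (T s, s)).comp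
        (ContinuousLinearMap.toSpanSingleton ℝ ((0 : ℝ), (1 : ℝ))) := hδ.mfderiv
      rw [h2, ContinuousLinearMap.comp_apply, ContinuousLinearMap.toSpanSingleton_apply, one_smul]
    have hFδ := hasDerivAt_comp_curve hδ.mdifferentiableAt (hFs.mdifferentiable hr0 (δ s))
    set w := diffAt Plane F (δ s) (diffTo Plane δ s 1)
    have hpos : HasDerivAt (fun σ => Y σ + T σ * Circle.exp σ) 0 s := by
      refine ((hYd s).add (hTd.ofReal_comp.mul (hasDerivAt_circleExp s))).congr_deriv ?_
      simp
    have hw : w = 0 := by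
      ext i
      have h2 := hasDerivAt_apply_coord hFδ i
      fin_cases i
      · refine h2.unique (hTd.congr_of_eventuallyEq (Filter.Eventually.of_forall fun σ => ?_))
        simp [δ, hτ]
      · refine h2.unique ((Complex.reCLM.hasFDerivAt.comp_hasDerivAt s hpos).congr_of_eventuallyEq
          (Filter.Eventually.of_forall fun σ => ?_))
        simp [δ, hFΦ]
      · refine h2.unique ((Complex.imCLM.hasFDerivAt.comp_hasDerivAt s hpos).congr_of_eventuallyEq
          (Filter.Eventually.of_forall fun σ => ?_))
        simp [δ, hFΦ]
    rw [hw] at hFδ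
    have h3 := IsCuspidalEdge.diffTo_eq_zero hr0 hFs (δ := δ) hcusp hδ.mdifferentiableAt
      (fun σ => (hΦs _ _).2 rfl) hFδ
    rw [hδ1] at h3
    have h4 : Injective (diffTo Plane Φ (T s, s)) :=
      ((hloc (T s, s)).mfderivToContinuousLinearEquiv hr0).injective
    have h5 := h4 (h3.trans (map_zero _).symm)
    simpa using congrArg Prod.snd h5

end CompleteNullFronts

theorem corollary4p6 {M : Type*} [TopologicalSpace M] [T2Space M] [SecondCountableTopology M]
    [ChartedSpace Plane M] (r : WithTop ℕ∞) (hr : r = ∞ ∨ r = ω)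
    [IsManifold (𝓡 2) ∞ M] [IsManifold (𝓡 2) r M]
    (F : M → Minkowski3) (hF : IsCompleteNullWaveFront r F) (hplane : ¬ IsPlanar F)
    (hself : ∃ K : Set Minkowski3, IsCompact K ∧ ∀ p q : M, p ≠ q → F p = F q → F p ∈ K) :
    4 ≤ {p : M | p ∈ singularSet F ∧ ¬ IsCuspidalEdge F p}.encard ∧
    ∀ p ∈ singularSet F, ∃ (t₀ ℓ : ℝ) (c ν : ℝ → Plane) (Φ : ℝ × ℝ → M),
      IsConvexClosedCurve r ℓ c ν ∧ IsGeneratedBy r F (connectedComponent p) t₀ ℓ c ν Φ ∧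
      4 ≤ {s : ℝ | s ∈ Ico 0 ℓ ∧ IsVertex c ν s}.encard ∧
      ∀ s, IsVertex c ν s →
        Φ (1 / planeCurvature c ν s, s) ∈ singularSet F ∧
          ¬ IsCuspidalEdge F (Φ (1 / planeCurvature c ν s, s)) := by
  have hr0 : r ≠ 0 := by rcases hr with rfl | rfl <;> simp
  have hr1 : 1 ≤ r := by rcases hr with rfl | rfl <;> simp
  have hrs : r + 1 = r := by rcases hr with rfl | rfl <;> rfl
  obtain ⟨K, hK, hself⟩ := hself
  have hgen := fun p (hp : p ∈ singularSet F) =>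
    hF.exists_isGeneratedBy hr0 hr1 hrs hK hself hp
  refine ⟨?_, hgen⟩
  obtain ⟨p, hp⟩ := hF.singular_nonempty
  obtain ⟨t₀, ℓ, c, ν, Φ, -, hΦ, hfour, hvert⟩ := hgen p hp
  -- Equal points have parameters differing by a multiple of `ℓ`, so distinct vertices in one period
  -- give distinct singular points.
  have hinj : InjOn (fun s => Φ (1 / planeCurvature c ν s, s))
      {s : ℝ | s ∈ Ico 0 ℓ ∧ IsVertex c ν s} := by
    intro s hs s' hs' h
    obtain ⟨-, k, hk⟩ := (hΦ.eq_iff _ _).1 h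
    exact eq_of_mem_Ico_of_eq_add_int_mul hs.1 hs'.1 hk
  refine hfour.trans (hinj.encard_image.symm.le.trans (encard_le_encard ?_))
  rintro _ ⟨s, hs, rfl⟩
  exact hvert s hs.2
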